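/- Let $n\ge 1$, let $\Omega\subset\mathbb R^n$ be a nonempty bounded open set, and let $f=f(x,s,\eta):\Omega\times\mathbb R\times\mathbb R^n\to\mathbb R$ be continuous, non-increasing in $s$, and locally Lipschitz continuous with respect to $\eta$ (that is, $f(x,s,\cdot)$ is locally Lipschitz on $\mathbb R^n$ for all $x\in\Omega$ and $s\in\mathbb R$). For $1<p<\infty$ consider the equation $$-\Delta_p u:=-\operatorname{div}\big(|\nabla u|^{p-2}\nabla u\big)=f(x,u,\nabla u)\quad\text{in }\Omega, \tag{E}$$ with the convention $|\eta|^{p-2}\eta=0$ for $\eta=0$. A function $u\in W^{1,p}_{loc}(\Omega)$ is a weak supersolution to (E) if $f(x,u,\nabla u)\in L^1_{loc}(\Omega)$ and $$\int_\Omega|\nabla u|^{p-2}\nabla u\cdot\nabla\psi\,dx\ \ge\ \int_\Omega f(x,u,\nabla u)\,\psi\,dx\qquad\text{for all }0\le\psi\in C_0^\infty(\Omega).$$ A lower semicontinuous function $u:\Omega\to(-\infty,+\infty]$, $u\not\equiv+\infty$, is a viscosity supersolution to (E) if for every $x_0\in\Omega$ and every $\varphi\in C^2(\Omega)$ such that $\varphi(x_0)=u(x_0)$,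 $u\ge\varphi$ in $\Omega$, and $\nabla\varphi(x)\ne0$ for all $x\in\Omega\setminus\{x_0\}$, one has $$\lim_{r\to0}\ \sup_{x\in B_r(x_0)\setminus\{x_0\}}\big(-\Delta_p\varphi(x)\big)\ \ge\ f(x_0,u(x_0),\nabla\varphi(x_0)),$$ where the left-hand side is an extended real number. Then the following hold, where a function $u\in W^{1,\infty}_{loc}(\Omega)$ is said to be a viscosity supersolution if it agrees almost everywhere in $\Omega$ with a continuous function on $\Omega$ (necessarily unique) which is a viscosity supersolution. (i) If $1<p\le2$ and $u\in W^{1,\infty}_{loc}(\Omega)$ is a weak supersolution to (E), then $u$ is a viscosity supersolution to (E). (ii) If $p>2$, $f(x,s,0)=0$ for all $x\in\Omega$ and $s\in\mathbb R$, and $u\in C^1(\Omega)$ is a weak supersolution to (E), then $u$ is a viscosity supersolution to (E). (iii) If $p>2$ and $u\in W^{1,\infty}_{loc}(\Omega)$ is a weak supersolution to (E) whose weak gradient satisfies $\nabla u\ne0$ almost everywhere in $\Omega$, then $u$ is a viscosity supersolution to (E). -/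

import Mathlib

open Filter Topology MeasureTheory
open scoped ContDiff ENNReal

noncomputable section

namespace PLap

/-- Euclidean space `ℝⁿ`. -/
abbrev E (n : ℕ) := EuclideanSpace ℝ (Fin n)

variable {n : ℕ}

/-- The vector field `A_p(η) = |η|^{p-2} η`. Its value at `η = 0` is `0`, for every `p`. -/
def flux (p : ℝ) (η : E n) : E n := ‖η‖ ^ (p - 2) • η

/-- The divergence `∑ i, ∂ᵢ Vᵢ` of a vector field on `ℝⁿ`. -/
def divergence (V : E n → E n) (x : E n) : ℝ :=
  ∑ i : Fin n, (fderiv ℝ V x (EuclideanSpace.single i 1)) i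

/-- The pointwise `p`-Laplacian `Δ_p φ = div (|∇φ|^{p-2} ∇φ)`. -/
def pLaplacian (p : ℝ) (φ : E n → ℝ) (x : E n) : ℝ :=
  divergence (fun y => flux p (gradient φ y)) x

/-- `ψ ∈ C₀^∞(Ω)`: smooth, with compact support contained in `Ω`. -/
structure IsTestFunction (Ω : Set (E n)) (ψ : E n → ℝ) : Prop where
  smooth : ContDiff ℝ ∞ ψ
  compact : HasCompactSupport ψ
  support_subset : tsupport ψ ⊆ Ω

/-- `g ∈ L^q_loc(Ω)`: `g` is in `L^q(K)` for every compact `K ⊆ Ω`. -/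
def MemLpLoc {F : Type*} [NormedAddCommGroup F] (q : ℝ≥0∞) (Ω : Set (E n)) (g : E n → F) : Prop :=
  ∀ K : Set (E n), IsCompact K → K ⊆ Ω → MemLp g q (volume.restrict K)

/-- `G` is the weak (distributional) gradient of `u` in `Ω`; it is unique up to null sets. -/
structure HasWeakGradient (Ω : Set (E n)) (u : E n → ℝ) (G : E n → E n) : Prop where
  locInt : MemLpLoc 1 Ω u
  locInt_grad : MemLpLoc 1 Ω G
  integral_eq : ∀ ψ : E n → ℝ, IsTestFunction Ω ψ →
    ∫ x in Ω, u x • gradient ψ x = - ∫ x in Ω, ψ x • G x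

/-- `u ∈ W^{1,q}_loc(Ω)`. -/
def MemW1Loc (q : ℝ≥0∞) (Ω : Set (E n)) (u : E n → ℝ) : Prop :=
  MemLpLoc q Ω u ∧ ∃ G : E n → E n, HasWeakGradient Ω u G ∧ MemLpLoc q Ω G

/-- `u ∈ W^{1,p}_loc(Ω)` is a weak supersolution of `-Δ_p u = f(x, u, ∇u)` in `Ω`.
The lower order term is required to be locally integrable, so that the right-hand side makes
sense; this is automatic when `f` is continuous and `u ∈ W^{1,∞}_loc(Ω)`. -/
def IsWeakSupersolution (Ω : Set (E n)) (p : ℝ) (f : E n → ℝ → E n → ℝ) (u : E n → ℝ) : Prop :=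
  MemLpLoc (ENNReal.ofReal p) Ω u ∧
  ∃ G : E n → E n, HasWeakGradient Ω u G ∧ MemLpLoc (ENNReal.ofReal p) Ω G ∧
    MemLpLoc 1 Ω (fun x => f x (u x) (G x)) ∧
    ∀ ψ : E n → ℝ, IsTestFunction Ω ψ → (∀ x, 0 ≤ ψ x) →
      ∫ x in Ω, f x (u x) (G x) * ψ x ≤ ∫ x in Ω, inner ℝ (flux p (G x)) (gradient ψ x)

/-- `u : Ω → (-∞, +∞]` is a viscosity supersolution of `-Δ_p u = f(x, u, ∇u)` in `Ω`.
The number `lim_{r → 0} sup_{B_r(x₀) \ {x₀}} (-Δ_p φ)` is a `limsup` along the punctured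
neighbourhoods of `x₀`, taken in the extended reals. -/
structure IsViscositySupersolution (Ω : Set (E n)) (p : ℝ) (f : E n → ℝ → E n → ℝ)
    (u : E n → EReal) : Prop where
  lsc : LowerSemicontinuousOn u Ω
  ne_bot : ∀ x ∈ Ω, u x ≠ ⊥
  exists_ne_top : ∃ x ∈ Ω, u x ≠ ⊤
  test : ∀ x₀ ∈ Ω, ∀ φ : E n → ℝ, ContDiffOn ℝ 2 φ Ω →
    u x₀ = (φ x₀ : EReal) →
    (∀ x ∈ Ω, (φ x : EReal) ≤ u x) →
    (∀ x ∈ Ω, x ≠ x₀ → gradient φ x ≠ 0) →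
    ((f x₀ (φ x₀) (gradient φ x₀) : ℝ) : EReal) ≤
      limsup (fun x => ((-pLaplacian p φ x : ℝ) : EReal)) (𝓝[≠] x₀)

end PLap

end

noncomputable section

namespace PLap

variable {n : ℕ}

/-! Suppose a test function φ touches the locally Lipschitz representative v from below at x₀ and
the viscosity inequality fails. Then -Δ_p φ ≤ c < f(x₀, φ(x₀), ∇φ(x₀)) on a punctured ball around
x₀. Lift φ to φ_m = φ + mζ, where ζ is a bump equal to 1 near x₀. Since ∇ζ = 0 near x₀ and ∇φ ≠ 0
away from it, the strict inequality survives for small m (`eventually_pLaplacian_add_const_mul_lt`).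
Now w = (φ_m - v)⁺ is Lipschitz, compactly supported, at most m, and positive at x₀.

Write A(η) = |η|^{p-2}η. Testing both inequalities with w and subtracting leaves the monotonicity
term D = ⟨A(∇φ_m) - A(∇v), ∇φ_m - ∇v⟩ ≥ 0 on {w > 0}, together with the error w·(f(x,v,∇φ_m) -
f(x,v,∇v)). By compactness and strict monotonicity of A, this difference of f is at most δ + K·D
(`exists_sub_le_add_mul_inner_flux`). As w ≤ m and Km < 1, the term K·w·D is absorbed by D, so that
δ∫w ≤ 0, a contradiction (`false_of_touching_of_strict`). The argument is uniform in p > 1.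

Two analytic points support this. The pointwise bound on -Δ_p φ_m holds only off x₀, where ∇φ_m may
vanish; continuity of the flux makes the point removable
(`integral_inner_gradient_le_of_divergence`). Functions in W^{1,∞}_loc must also be replaced by
locally Lipschitz ones, and smooth test functions by Lipschitz ones; both are done by mollification.
-/

/-! ### The vector field |η|^{p-2}η and its monotonicity. -/

theorem norm_flux {p : ℝ} (hp : 1 < p) (η : E n) : ‖flux p η‖ = ‖η‖ ^ (p - 1) := by
  unfold flux
  rw [norm_smul, Real.norm_of_nonneg (by positivity)]
  rcases eq_or_ne ‖η‖ 0 with h | h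
  · rw [h, mul_zero, Real.zero_rpow (by linarith)]
  · rw [← Real.rpow_add_one h]; congr 1; ring

theorem contDiffAt_flux (p : ℝ) {η : E n} (hη : η ≠ 0) : ContDiffAt ℝ 1 (flux p) η := by
  unfold flux
  exact ((contDiffAt_norm ℝ hη).rpow_const_of_ne (norm_ne_zero_iff.2 hη)).smul contDiffAt_id

theorem continuous_flux {p : ℝ} (hp : 1 < p) : Continuous (flux p : E n → E n) := by
  rw [continuous_iff_continuousAt]
  intro η
  rcases eq_or_ne η 0 with rfl | h
  · have h0 : flux p (0 : E n) = 0 := by simp [flux]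
    rw [ContinuousAt, h0, tendsto_zero_iff_norm_tendsto_zero]
    simp_rw [norm_flux hp]
    have : ContinuousAt (fun η : E n => ‖η‖ ^ (p - 1)) 0 :=
      continuousAt_id.norm.rpow_const (Or.inr (by linarith))
    simpa [ContinuousAt, Real.zero_rpow (by linarith : p - 1 ≠ 0)] using this
  · exact (contDiffAt_flux p h).continuousAt

/-- Strict monotonicity of the vector field `A_p`. -/
theorem inner_flux_sub_pos {p : ℝ} (hp : 1 < p) {a b : E n} (hab : a ≠ b) :
    0 < inner ℝ (flux p a - flux p b) (a - b) := by
  -- The first summand is radial, positive when the norms differ because t ↦ t^{p-1} is strictly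
  -- increasing. The second is angular, nonnegative by Cauchy–Schwarz, and positive when the norms
  -- agree but a ≠ b.
  have key : inner ℝ (flux p a - flux p b) (a - b) =
      (‖flux p a‖ - ‖flux p b‖) * (‖a‖ - ‖b‖) +
        (‖a‖ ^ (p - 2) + ‖b‖ ^ (p - 2)) * (‖a‖ * ‖b‖ - inner ℝ a b) := by
    simp only [flux, inner_sub_left, inner_sub_right, inner_smul_left, norm_smul,
      real_inner_self_eq_norm_sq, real_inner_comm a b, RCLike.conj_to_real, Real.norm_eq_abs,
      abs_of_nonneg (Real.rpow_nonneg (norm_nonneg _) _)]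
    ring
  rw [key, norm_flux hp, norm_flux hp]
  have hcs := real_inner_le_norm a b
  have hp1 : 0 < p - 1 := by linarith
  have hs : 0 ≤ ‖a‖ ^ (p - 2) + ‖b‖ ^ (p - 2) := by positivity
  rcases lt_trichotomy ‖a‖ ‖b‖ with h | h | h
  · have := Real.rpow_lt_rpow (norm_nonneg a) h hp1
    have h2 := mul_nonneg hs (sub_nonneg.2 hcs)
    nlinarith
  · have h1 : 0 < ‖a‖ := by
      refine lt_of_le_of_ne (norm_nonneg a) fun h0 => hab ?_
      rw [norm_eq_zero.1 h0.symm, norm_eq_zero.1 (h0.trans h).symm]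
    have h2 : 0 < ‖a‖ * ‖b‖ - inner ℝ a b := by
      have h3 : 0 < ‖a - b‖ := norm_pos_iff.2 (sub_ne_zero.2 hab)
      have h4 := norm_sub_sq_real a b
      rw [← h] at h4 ⊢
      nlinarith
    have h3 : 0 < ‖a‖ ^ (p - 2) + ‖b‖ ^ (p - 2) := by
      have := Real.rpow_pos_of_pos h1 (p - 2)
      positivity
    have := mul_pos h3 h2
    rw [h] at this ⊢
    simpa using this
  · have := Real.rpow_lt_rpow (norm_nonneg b) h hp1
    have h2 := mul_nonneg hs (sub_nonneg.2 hcs)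
    nlinarith

theorem inner_flux_sub_nonneg {p : ℝ} (hp : 1 < p) (a b : E n) :
    0 ≤ inner ℝ (flux p a - flux p b) (a - b) := by
  rcases eq_or_ne a b with rfl | h
  · simp
  · exact (inner_flux_sub_pos hp h).le

/-- On bounded sets the modulus of continuity of `f` in the gradient variable is controlled by the
monotonicity of `A_p`, up to an arbitrarily small constant. -/
theorem exists_sub_le_add_mul_inner_flux {p : ℝ} (hp : 1 < p) {f : E n → ℝ → E n → ℝ}
    {B : Set (E n)} (hB : IsCompact B)
    (hf : ContinuousOn (fun z : E n × ℝ × E n => f z.1 z.2.1 z.2.2) (B ×ˢ Set.univ))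
    (S M : ℝ) {δ : ℝ} (hδ : 0 < δ) :
    ∃ K : ℝ, 0 ≤ K ∧ ∀ x ∈ B, ∀ s : ℝ, |s| ≤ S → ∀ a b : E n, ‖a‖ ≤ M → ‖b‖ ≤ M →
      f x s a - f x s b ≤ δ + K * inner ℝ (flux p a - flux p b) (a - b) := by
  let T : Set (E n × ℝ × E n × E n) :=
    B ×ˢ Metric.closedBall 0 S ×ˢ Metric.closedBall 0 M ×ˢ Metric.closedBall 0 M
  have hT : IsCompact T := hB.prod ((isCompact_closedBall _ _).prod
    ((isCompact_closedBall _ _).prod (isCompact_closedBall _ _)))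
  let F : E n × ℝ × E n × E n → ℝ := fun z => f z.1 z.2.1 z.2.2.1 - f z.1 z.2.1 z.2.2.2
  have hF : ContinuousOn F T := by
    refine ContinuousOn.sub ?_ ?_
    · exact hf.comp (f := fun z : E n × ℝ × E n × E n => (z.1, z.2.1, z.2.2.1))
        (by fun_prop) fun z hz => ⟨hz.1, trivial⟩
    · exact hf.comp (f := fun z : E n × ℝ × E n × E n => (z.1, z.2.1, z.2.2.2))
        (by fun_prop) fun z hz => ⟨hz.1, trivial⟩
  let D : E n × ℝ × E n × E n → ℝ := fun z =>
    inner ℝ (flux p z.2.2.1 - flux p z.2.2.2) (z.2.2.1 - z.2.2.2)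
  have hD : Continuous D := by
    have := continuous_flux (n := n) hp
    fun_prop
  -- On the compact set where the increment of f is at least δ one has a ≠ b, so D has a positive
  -- minimum there. An upper bound of the increment divided by this minimum serves as K; off this
  -- set δ alone suffices.
  let Z := T ∩ F ⁻¹' Set.Ici δ
  have hZ : IsCompact Z := hT.of_isClosed_subset
    (hF.preimage_isClosed_of_isClosed hT.isClosed isClosed_Ici) Set.inter_subset_left
  obtain ⟨C, hC⟩ := hT.bddAbove_image hF
  have hmem : ∀ x ∈ B, ∀ s : ℝ, |s| ≤ S → ∀ a b : E n, ‖a‖ ≤ M → ‖b‖ ≤ M →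
      ((x, s, a, b) : E n × ℝ × E n × E n) ∈ T := fun x hx s hs a b ha hb =>
    ⟨hx, by simpa using hs, by simpa using ha, by simpa using hb⟩
  rcases Z.eq_empty_or_nonempty with hZe | hZn
  · refine ⟨0, le_rfl, fun x hx s hs a b ha hb => ?_⟩
    by_contra! h
    have : ((x, s, a, b) : E n × ℝ × E n × E n) ∈ Z :=
      ⟨hmem x hx s hs a b ha hb, by
        simp only [Set.mem_preimage, Set.mem_Ici, F]; linarith⟩
    simp [hZe] at this
  · obtain ⟨z, hz, hmin⟩ := hZ.exists_isMinOn hZn hD.continuousOn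
    have hd : 0 < D z := by
      refine inner_flux_sub_pos hp fun h => ?_
      have h2 : δ ≤ F z := hz.2
      simp only [F, h, sub_self] at h2
      linarith
    have hC0 : 0 ≤ C := hδ.le.trans ((show δ ≤ F z from hz.2).trans (hC ⟨z, hz.1, rfl⟩))
    refine ⟨C / D z, by positivity, fun x hx s hs a b ha hb => ?_⟩
    have hm := hmem x hx s hs a b ha hb
    have h0 : 0 ≤ D (x, s, a, b) := inner_flux_sub_nonneg hp a b
    by_cases h : δ ≤ F (x, s, a, b)
    · have h1 : D z ≤ D (x, s, a, b) := hmin ⟨hm, h⟩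
      have h2 : F (x, s, a, b) ≤ C := hC ⟨_, hm, rfl⟩
      have h3 : C ≤ C / D z * D (x, s, a, b) := by
        rw [div_mul_eq_mul_div, le_div_iff₀ hd]
        gcongr
      change F (x, s, a, b) ≤ δ + C / D z * D (x, s, a, b)
      linarith
    · push Not at h
      have h3 : 0 ≤ C / D z * D (x, s, a, b) := by positivity
      change F (x, s, a, b) ≤ δ + C / D z * D (x, s, a, b)
      linarith

/-! ### Gradients of Lipschitz functions and integration by parts. -/

theorem norm_gradient_le {g : E n → ℝ} {C : NNReal} (hg : LipschitzWith C g) (x : E n) :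
    ‖gradient g x‖ ≤ C := by
  rw [gradient, LinearIsometryEquiv.norm_map]
  exact norm_fderiv_le_of_lipschitz ℝ hg

theorem measurable_gradient (g : E n → ℝ) : Measurable (gradient g) :=
  (InnerProductSpace.toDual ℝ (E n)).symm.continuous.measurable.comp (measurable_fderiv ℝ g)

theorem gradient_apply (g : E n → ℝ) (x : E n) (i : Fin n) :
    gradient g x i = fderiv ℝ g x (EuclideanSpace.single i 1) := by
  rw [← inner_gradient_left, EuclideanSpace.inner_single_right]
  simp

theorem gradient_eq_zero_of_notMem_tsupport {g : E n → ℝ} {x : E n} (hx : x ∉ tsupport g) :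
    gradient g x = 0 := by
  rw [gradient, show fderiv ℝ g x = 0 by
    by_contra h
    exact hx (support_fderiv_subset ℝ h), map_zero]

theorem gradient_congr {g h : E n → ℝ} {x : E n} (hgh : g =ᶠ[𝓝 x] h) :
    gradient g x = gradient h x := by
  rw [gradient, gradient, hgh.fderiv_eq]

theorem integrable_of_bound_of_compact {F : Type*} [NormedAddCommGroup F] {X : E n → F}
    (hX : AEStronglyMeasurable X volume) {K : Set (E n)} (hK : IsCompact K) {C : ℝ}
    (hC : ∀ x ∈ K, ‖X x‖ ≤ C) (h0 : ∀ x ∉ K, X x = 0) : Integrable X volume := by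
  rw [← integrableOn_iff_integrable_of_support_subset (s := K)
    fun x hx => by_contra fun h => hx (h0 x h)]
  refine Measure.integrableOn_of_bounded (M := C) hK.measure_lt_top.ne hX ?_
  filter_upwards [ae_restrict_mem hK.measurableSet] with x hx using hC x hx

theorem integrable_smul_gradient {v g : E n → ℝ} {C : NNReal} (hv : Continuous v)
    (hg : LipschitzWith C g) (hgc : HasCompactSupport g) :
    Integrable (fun x => v x • gradient g x) volume := by
  obtain ⟨D, hD⟩ := (IsCompact.bddAbove_image hgc hv.norm.continuousOn)
  refine integrable_of_bound_of_compact (K := tsupport g) (C := D * C)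
    (hv.measurable.aestronglyMeasurable.smul (measurable_gradient g).aestronglyMeasurable) hgc
    (fun x hx => ?_) fun x hx => by rw [gradient_eq_zero_of_notMem_tsupport hx, smul_zero]
  rw [norm_smul]
  have h1 : ‖v x‖ ≤ D := hD ⟨x, hx, rfl⟩
  exact mul_le_mul h1 (norm_gradient_le hg x) (norm_nonneg _) ((norm_nonneg _).trans h1)

theorem integrable_smul_gradient_of_hasCompactSupport {v g : E n → ℝ} {C : NNReal}
    (hv : Continuous v) (hvc : HasCompactSupport v) (hg : LipschitzWith C g) :
    Integrable (fun x => v x • gradient g x) volume :=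
  (hv.integrable_of_hasCompactSupport hvc).smul_of_top_left
    (memLp_top_of_bound (measurable_gradient g).aestronglyMeasurable C
      (Eventually.of_forall (norm_gradient_le hg)))

/-- Integration by parts for Lipschitz functions, one of them compactly supported. -/
theorem integral_smul_gradient_eq_neg {v g : E n → ℝ} {C D : NNReal} (hv : LipschitzWith C v)
    (hg : LipschitzWith D g) (hgc : HasCompactSupport g) :
    ∫ x, v x • gradient g x = - ∫ x, g x • gradient v x := by
  refine ext_inner_left ℝ fun e => ?_
  rw [inner_neg_right, ← integral_inner (integrable_smul_gradient hv.continuous hg hgc),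
    ← integral_inner (integrable_smul_gradient_of_hasCompactSupport hg.continuous hgc hv),
    ← integral_neg]
  have h1 := LipschitzWith.integral_lineDeriv_mul_eq (μ := volume) hv hg hgc (-e)
  have h2 : ∀ᵐ x, inner ℝ e (v x • gradient g x) = lineDeriv ℝ g x (- -e) * v x := by
    filter_upwards [hg.ae_differentiableAt (μ := volume)] with x hx
    rw [hx.lineDeriv_eq_fderiv, inner_smul_right, inner_gradient_right, neg_neg, mul_comm]
    simp
  have h3 : ∀ᵐ x, -inner ℝ e (g x • gradient v x) = lineDeriv ℝ v x (-e) * g x := by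
    filter_upwards [hv.ae_differentiableAt (μ := volume)] with x hx
    rw [hx.lineDeriv_eq_fderiv, inner_smul_right, inner_gradient_right, map_neg]
    simp [mul_comm]
  rw [integral_congr_ae h2, integral_congr_ae h3, h1]

theorem integral_gradient_eq_zero {g : E n → ℝ} {C : NNReal} (hg : LipschitzWith C g)
    (hgc : HasCompactSupport g) : ∫ x, gradient g x = 0 := by
  have h := integral_smul_gradient_eq_neg (LipschitzWith.const (1 : ℝ)) hg hgc
  have h0 : ∀ x : E n, gradient (fun _ : E n => (1 : ℝ)) x = 0 := fun x => by simp [gradient]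
  simpa [h0] using h

theorem exists_smooth_cutoff {K U : Set (E n)} (hK : IsCompact K) (hU : IsOpen U) (hKU : K ⊆ U) :
    ∃ κ : E n → ℝ, ContDiff ℝ ∞ κ ∧ HasCompactSupport κ ∧ tsupport κ ⊆ U ∧
      ∀ x ∈ K, κ =ᶠ[𝓝 x] fun _ => 1 := by
  obtain ⟨L, hL, hKL, hLU⟩ := exists_compact_between hK hU hKU
  obtain ⟨κ, h1, h0, -⟩ := exists_contMDiffMap_one_nhds_of_subset_interior
    (n := ⊤) (modelWithCornersSelf ℝ (E n)) hK.isClosed hKL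
  have hsupp : tsupport κ ⊆ L := closure_minimal
    (fun x hx => by_contra fun h => hx (h0 x h)) hL.isClosed
  refine ⟨κ, κ.contMDiff.contDiff, hL.of_isClosed_subset (isClosed_tsupport _) hsupp,
    hsupp.trans hLU, fun x hx => ?_⟩
  exact h1.filter_mono (nhds_le_nhdsSet hx)

theorem contDiff_smul_of_tsupport_subset {F : Type*} [NormedAddCommGroup F] [NormedSpace ℝ F]
    {m : ℕ∞} {U : Set (E n)} (hU : IsOpen U) {κ : E n → ℝ} (hκ : ContDiff ℝ ∞ κ)
    (hκU : tsupport κ ⊆ U) {W : E n → F} (hW : ContDiffOn ℝ m W U) :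
    ContDiff ℝ m (fun x => κ x • W x) := by
  refine contDiff_iff_contDiffAt.2 fun x => ?_
  by_cases hx : x ∈ tsupport fun x => κ x • W x
  swap
  · exact contDiffAt_const.congr_of_eventuallyEq (notMem_tsupport_iff_eventuallyEq.1 hx)
  have hxU : x ∈ U := hκU (closure_mono (Function.support_smul_subset_left κ W) hx)
  exact (hκ.contDiffAt.of_le (by exact_mod_cast le_top)).smul (hW.contDiffAt (hU.mem_nhds hxU))

theorem inner_eq_sum (a b : E n) : inner ℝ a b = ∑ i, b i * a i := by
  simp [PiLp.inner_apply]

/-- Divergence theorem against a compactly supported Lipschitz function. -/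
theorem integral_inner_gradient_eq_neg_divergence {U : Set (E n)} (hU : IsOpen U)
    {W : E n → E n} (hW : ContDiffOn ℝ 1 W U) {g : E n → ℝ} {C : NNReal}
    (hg : LipschitzWith C g) (hgc : HasCompactSupport g) (hgU : tsupport g ⊆ U) :
    Integrable (fun x => divergence W x * g x) volume ∧
      ∫ x, inner ℝ (W x) (gradient g x) = - ∫ x, divergence W x * g x := by
  -- W is C¹ only on U. Multiplied by a cutoff equal to 1 near the support of g, its components
  -- become globally Lipschitz, and integration by parts applies to each of them.
  obtain ⟨κ, hκ, hκc, hκU, hκ1⟩ := exists_smooth_cutoff hgc hU hgU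
  have hV : ContDiff ℝ 1 (fun x => κ x • W x) :=
    contDiff_smul_of_tsupport_subset (m := 1) hU hκ hκU hW
  set V : E n → E n := fun x => κ x • W x with hVdef
  have hVW : ∀ x ∈ tsupport g, V =ᶠ[𝓝 x] W := fun x hx => by
    filter_upwards [hκ1 x hx] with y hy
    simp [hVdef, hy]
  have hVi : ∀ i, ContDiff ℝ 1 (fun x => V x i) := fun i => by fun_prop
  have hVc : ∀ i, HasCompactSupport (fun x => V x i) := fun i => by
    have : HasCompactSupport V := hκc.smul_right
    exact this.comp_left (g := fun y : E n => y i) rfl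
  choose D hD using fun i => (hVi i).lipschitzWith_of_hasCompactSupport (hVc i) one_ne_zero
  have hfd : ∀ x (i : Fin n), fderiv ℝ (fun x => V x i) x (EuclideanSpace.single i 1) =
      (fderiv ℝ V x (EuclideanSpace.single i 1)) i := fun x i => by
    have h1 : HasFDerivAt V (fderiv ℝ V x) x := (hV.differentiable one_ne_zero x).hasFDerivAt
    have h2 : HasFDerivAt (fun x => V x i)
        ((EuclideanSpace.proj i : E n →L[ℝ] ℝ).comp (fderiv ℝ V x)) x :=
      (EuclideanSpace.proj i : E n →L[ℝ] ℝ).hasFDerivAt.comp x h1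
    rw [h2.fderiv]
    rfl
  have hdiv : ∀ x, divergence W x * g x =
      ∑ i, lineDeriv ℝ (fun x => V x i) x (EuclideanSpace.single i 1) * g x := fun x => by
    by_cases hx : x ∈ tsupport g
    · rw [divergence, Finset.sum_mul]
      refine Finset.sum_congr rfl fun i _ => ?_
      rw [((hVi i).differentiable one_ne_zero x).lineDeriv_eq_fderiv, hfd, (hVW x hx).fderiv_eq]
    · simp [image_eq_zero_of_notMem_tsupport hx]
  have hgr : ∀ᵐ x, inner ℝ (W x) (gradient g x) =
      - ∑ i, lineDeriv ℝ g x (-EuclideanSpace.single i 1) * V x i := by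
    filter_upwards [hg.ae_differentiableAt (μ := volume)] with x hx
    rw [inner_eq_sum, ← Finset.sum_neg_distrib]
    refine Finset.sum_congr rfl fun i _ => ?_
    rw [hx.lineDeriv_eq_fderiv, map_neg, ← gradient_apply]
    by_cases hxs : x ∈ tsupport g
    · rw [(hVW x hxs).self_of_nhds]; ring
    · simp [gradient_eq_zero_of_notMem_tsupport hxs]
  have hI : ∀ i, Integrable
      (fun x => lineDeriv ℝ (fun x => V x i) x (EuclideanSpace.single i 1) * g x) volume := by
    intro i
    refine Continuous.integrable_of_hasCompactSupport ?_ hgc.mul_left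
    refine Continuous.mul ?_ hg.continuous
    simp only [((hVi i).differentiable one_ne_zero _).lineDeriv_eq_fderiv]
    exact ((hVi i).continuous_fderiv one_ne_zero).clm_apply continuous_const
  have hJ : ∀ i, Integrable
      (fun x => lineDeriv ℝ g x (-EuclideanSpace.single i 1) * V x i) volume := by
    intro i
    exact ((hVi i).continuous.integrable_of_hasCompactSupport (hVc i)).mul_of_top_right
      (hg.memLp_lineDeriv _)
  refine ⟨?_, ?_⟩
  · simp_rw [hdiv]
    exact integrable_finsetSum _ fun i _ => hI i
  · rw [integral_congr_ae hgr, integral_neg, integral_finsetSum _ fun i _ => hJ i]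
    simp_rw [hdiv]
    rw [integral_finsetSum _ fun i _ => hI i]
    congr 1
    refine Finset.sum_congr rfl fun i _ => ?_
    rw [LipschitzWith.integral_lineDeriv_mul_eq (hD i) hg hgc]

/-! ### Mollification and locally Lipschitz representatives. -/

open scoped Convolution

/-- The bounded ratio of outer to inner radius is what almost everywhere convergence of
mollifications of a locally integrable function requires; the bound by δ controls the growth of
supports. -/
theorem exists_bump_seq {δ : ℝ} (hδ : 0 < δ) :
    ∃ ρ : ℕ → ContDiffBump (0 : E n), Tendsto (fun k => (ρ k).rOut) atTop (𝓝 0) ∧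
      (∀ k, (ρ k).rOut ≤ 2 * (ρ k).rIn) ∧ ∀ k, (ρ k).rOut < δ := by
  refine ⟨fun k => ⟨δ / 4 / (k + 1), δ / 2 / (k + 1), by positivity, by gcongr; norm_num⟩, ?_,
    fun k => le_of_eq (by ring), fun k => ?_⟩
  · have := (tendsto_one_div_add_atTop_nhds_zero_nat (𝕜 := ℝ)).const_mul (δ / 2)
    simpa [div_eq_mul_inv] using this
  · change δ / 2 / (k + 1) < δ
    rw [div_lt_iff₀ (by positivity)]
    have : (0 : ℝ) ≤ k := by positivity
    nlinarith

/-- The kernel is a probability density, so mollifying averages and cannot exceed an almost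
everywhere bound. This gives the uniform Lipschitz constants and the dominating functions used
below. -/
theorem norm_normed_convolution_le {F : Type*} [NormedAddCommGroup F] [NormedSpace ℝ F]
    (ρ : ContDiffBump (0 : E n)) {g : E n → F} {M : ℝ} (hg : ∀ᵐ x, ‖g x‖ ≤ M) (x : E n) :
    ‖(ρ.normed volume ⋆[ContinuousLinearMap.lsmul ℝ ℝ, volume] g) x‖ ≤ M := by
  rw [convolution]
  have h1 : ∀ᵐ t, ‖(ContinuousLinearMap.lsmul ℝ ℝ) (ρ.normed volume t) (g (x - t))‖ ≤
      ρ.normed volume t * M := by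
    have := (quasiMeasurePreserving_sub_left_of_right_invariant volume x).ae hg
    filter_upwards [this] with t ht
    rw [ContinuousLinearMap.lsmul_apply, norm_smul, Real.norm_of_nonneg (ρ.nonneg_normed t)]
    exact mul_le_mul_of_nonneg_left ht (ρ.nonneg_normed t)
  refine (norm_integral_le_of_norm_le (ρ.integrable_normed.mul_const M) h1).trans (le_of_eq ?_)
  rw [integral_mul_const, ρ.integral_normed, one_mul]

theorem gradient_comp_const_sub {ρ : E n → ℝ} (hρ : Differentiable ℝ ρ) (x y : E n) :
    gradient (fun z => ρ (x - z)) y = - gradient ρ (x - y) := by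
  have h1 : HasFDerivAt (fun z : E n => x - z) (-ContinuousLinearMap.id ℝ (E n)) y :=
    (hasFDerivAt_id y).const_sub x
  have h2 := (hρ (x - y)).hasFDerivAt.comp y h1
  have h3 : fderiv ℝ (fun z => ρ (x - z)) y = -fderiv ℝ ρ (x - y) := by
    rw [show (fun z => ρ (x - z)) = ρ ∘ fun z => x - z from rfl, h2.fderiv]
    ext; simp
  rw [gradient, h3, map_neg, gradient]

/-- Mollification commutes with the weak gradient. -/
theorem hasGradientAt_convolution {U : Set (E n)} {u : E n → ℝ} {G : E n → E n}
    (hu : LocallyIntegrable u volume)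
    (h : ∀ ψ : E n → ℝ, IsTestFunction U ψ →
      ∫ x in U, u x • gradient ψ x = - ∫ x in U, ψ x • G x)
    (ρ : ContDiffBump (0 : E n)) {x : E n} (hx : Metric.closedBall x ρ.rOut ⊆ U) :
    HasGradientAt (ρ.normed volume ⋆[ContinuousLinearMap.lsmul ℝ ℝ, volume] u)
      ((ρ.normed volume ⋆[ContinuousLinearMap.lsmul ℝ ℝ, volume] G) x) x := by
  have hρ : ContDiff ℝ ∞ (ρ.normed volume) := ρ.contDiff_normed
  have hD := ρ.hasCompactSupport_normed.hasFDerivAt_convolution_left (μ := volume)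
    (ContinuousLinearMap.lsmul ℝ ℝ) (hρ.of_le (by exact_mod_cast le_top)) hu x
  rw [hasGradientAt_iff_hasFDerivAt]
  convert! hD using 1
  apply (InnerProductSpace.toDual ℝ (E n)).symm.injective
  rw [LinearIsometryEquiv.symm_apply_apply]
  -- The reflected kernel centred at x is an admissible test function because the closed ball lies
  -- in U; the weak gradient identity for it is the claim.
  set ψ : E n → ℝ := fun z => ρ.normed volume (x - z) with hψ
  have hsupp : tsupport ψ ⊆ Metric.closedBall x ρ.rOut := by
    refine closure_minimal (fun z hz => ?_) Metric.isClosed_closedBall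
    have h1 : x - z ∈ Function.support (ρ.normed volume) := hz
    rw [ρ.support_normed_eq, mem_ball_zero_iff] at h1
    rw [mem_closedBall_iff_norm, norm_sub_rev]
    exact h1.le
  have hψt : IsTestFunction U ψ :=
    ⟨hρ.comp (contDiff_const.sub contDiff_id),
      (isCompact_closedBall x ρ.rOut).of_isClosed_subset (isClosed_tsupport _) hsupp,
      hsupp.trans hx⟩
  have hgr : ∀ y, gradient ψ y = - gradient (ρ.normed volume) (x - y) :=
    gradient_comp_const_sub (hρ.differentiable (by simp)) x
  have key := h ψ hψt
  rw [setIntegral_eq_integral_of_forall_compl_eq_zero, setIntegral_eq_integral_of_forall_compl_eq_zero]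
    at key
  rotate_left
  · intro y hy
    rw [image_eq_zero_of_notMem_tsupport fun h => hy (hψt.support_subset h), zero_smul]
  · intro y hy
    rw [gradient_eq_zero_of_notMem_tsupport fun h => hy (hψt.support_subset h), smul_zero]
  have e1 : (ρ.normed volume ⋆[ContinuousLinearMap.lsmul ℝ ℝ, volume] G) x = ∫ y, ψ y • G y := by
    rw [convolution_eq_swap]; rfl
  rw [e1, ← neg_eq_iff_eq_neg.2 key, ← integral_neg, convolution_eq_swap]
  -- The inverse Riesz map is conjugate-linear by type; over ℝ it is linear, and in this form it can
  -- be pulled out of the integral.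
  let L : (E n →L[ℝ] ℝ) ≃L[ℝ] E n :=
    { toFun := (InnerProductSpace.toDual ℝ (E n)).symm
      invFun := InnerProductSpace.toDual ℝ (E n)
      map_add' := map_add _
      map_smul' := by simp
      left_inv := fun _ => LinearIsometryEquiv.apply_symm_apply _ _
      right_inv := fun _ => LinearIsometryEquiv.symm_apply_apply _ _
      continuous_toFun := LinearIsometryEquiv.continuous _
      continuous_invFun := LinearIsometryEquiv.continuous _ }
  refine Eq.trans (integral_congr_ae (Eventually.of_forall fun y => ?_)) (L.integral_comp_comm _)
  change _ = (InnerProductSpace.toDual ℝ (E n)).symm _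
  simp only [hgr, smul_neg, neg_neg]
  rw [gradient, ← map_smul]
  congr 1
  ext e
  simp [mul_comm]

theorem MemLpLoc.integrable_smul {F : Type*} [NormedAddCommGroup F] [NormedSpace ℝ F]
    {Ω : Set (E n)} {G : E n → F} (hG : MemLpLoc 1 Ω G) {κ : E n → ℝ} (hκ : Continuous κ)
    (hκc : HasCompactSupport κ) (hκΩ : tsupport κ ⊆ Ω) :
    Integrable (fun x => κ x • G x) volume := by
  rw [← integrableOn_iff_integrable_of_support_subset (f := fun x => κ x • G x) (s := tsupport κ)
    ((Function.support_smul_subset_left κ G).trans (subset_tsupport _))]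
  have h1 : IntegrableOn G (tsupport κ) volume := memLp_one_iff_integrable.1 (hG _ hκc hκΩ)
  obtain ⟨C, hC⟩ := hκ.bounded_above_of_compact_support hκc
  exact h1.bdd_smul C hκ.aestronglyMeasurable (Eventually.of_forall hC)

theorem setIntegral_smul_gradient {F : Type*} [NormedAddCommGroup F] [NormedSpace ℝ F]
    {Ω : Set (E n)} {κ : E n → ℝ} (hκΩ : tsupport κ ⊆ Ω) (G : E n → F) :
    ∫ x in Ω, κ x • G x = ∫ x, κ x • G x :=
  setIntegral_eq_integral_of_forall_compl_eq_zero fun x hx => by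
    rw [image_eq_zero_of_notMem_tsupport fun h => hx (hκΩ h), zero_smul]

/-- A function with locally bounded weak gradient is locally almost everywhere equal to a Lipschitz
function. -/
theorem exists_lipschitzWith_ae_eq {Ω : Set (E n)} {u : E n → ℝ} {G : E n → E n}
    (h : HasWeakGradient Ω u G) (hG : MemLpLoc ∞ Ω G) {a : E n} {r : ℝ} (hr : 0 < r)
    (ha : Metric.closedBall a (2 * r) ⊆ Ω) :
    ∃ (C : NNReal) (v : E n → ℝ), LipschitzWith C v ∧
      v =ᵐ[volume.restrict (Metric.ball a r)] u := by
  set K := Metric.closedBall a (2 * r) with hK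
  set U := Metric.ball a (2 * r) with hU
  have hKc : IsCompact K := isCompact_closedBall _ _
  have hUK : U ⊆ K := Metric.ball_subset_closedBall
  have hu1 : Integrable (K.indicator u) volume :=
    (integrable_indicator_iff hKc.measurableSet).2 (memLp_one_iff_integrable.1 (h.locInt K hKc ha))
  have hw : ∀ ψ : E n → ℝ, IsTestFunction U ψ →
      ∫ x in U, K.indicator u x • gradient ψ x = - ∫ x in U, ψ x • K.indicator G x := by
    intro ψ hψ
    have h1 := h.integral_eq ψ ⟨hψ.smooth, hψ.compact, hψ.support_subset.trans (hUK.trans ha)⟩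
    rw [setIntegral_smul_gradient (hψ.support_subset.trans (hUK.trans ha)),
      setIntegral_eq_integral_of_forall_compl_eq_zero] at h1
    · rw [setIntegral_smul_gradient hψ.support_subset,
        setIntegral_eq_integral_of_forall_compl_eq_zero]
      · convert! h1 using 2
        · ext1 x
          by_cases hx : x ∈ K
          · rw [Set.indicator_of_mem hx]
          · rw [gradient_eq_zero_of_notMem_tsupport fun h => hx (hUK (hψ.support_subset h))]
            simp
        · refine integral_congr_ae (Eventually.of_forall fun x => ?_)
          by_cases hx : x ∈ K
          · simp only [Set.indicator_of_mem hx]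
          · simp only [image_eq_zero_of_notMem_tsupport
              fun h => hx (hUK (hψ.support_subset h)), zero_smul]
      · intro x hx
        rw [gradient_eq_zero_of_notMem_tsupport fun h => hx (hψ.support_subset h), smul_zero]
    · intro x hx
      rw [gradient_eq_zero_of_notMem_tsupport
        fun h => hx (ha (hUK (hψ.support_subset h))), smul_zero]
  obtain ⟨M, hM⟩ : ∃ M : NNReal, ∀ᵐ x, ‖K.indicator G x‖ ≤ M := by
    have h1 := hG K hKc ha
    refine ⟨(eLpNorm G ∞ (volume.restrict K)).toNNReal, ?_⟩
    have h2 := enorm_ae_le_eLpNormEssSup G (volume.restrict K)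
    rw [ae_restrict_iff' hKc.measurableSet] at h2
    filter_upwards [h2] with x hx
    by_cases hxK : x ∈ K
    · rw [Set.indicator_of_mem hxK]
      have h3 := hx hxK
      rw [← eLpNorm_exponent_top] at h3
      have h4 := (ENNReal.toNNReal_le_toNNReal (by simp) h1.2.ne).2 h3
      simpa using (NNReal.coe_le_coe.2 h4)
    · rw [Set.indicator_of_notMem hxK]; simp
  obtain ⟨ρ, hρ0, hρ2, hρr⟩ := exists_bump_seq (n := n) hr
  -- All mollifications are M-Lipschitz on the ball, so their pointwise limit is M-Lipschitz on the
  -- full-measure set S where they converge to u. A Lipschitz extension from S is the required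
  -- function.
  set S : Set (E n) := {x ∈ Metric.ball a r | Tendsto
    (fun k => ((ρ k).normed volume ⋆[ContinuousLinearMap.lsmul ℝ ℝ, volume] K.indicator u) x)
    atTop (𝓝 (K.indicator u x))} with hS
  have hlipk : ∀ k, LipschitzOnWith M
      ((ρ k).normed volume ⋆[ContinuousLinearMap.lsmul ℝ ℝ, volume] K.indicator u)
      (Metric.ball a r) := by
    intro k
    refine Convex.lipschitzOnWith_of_nnnorm_hasFDerivWithin_le (𝕜 := ℝ)
      (f' := fun x => InnerProductSpace.toDual ℝ (E n)
        (((ρ k).normed volume ⋆[ContinuousLinearMap.lsmul ℝ ℝ, volume] K.indicator G) x))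
      (fun x hx => ?_) (fun x hx => ?_) (convex_ball a r)
    · refine (hasGradientAt_iff_hasFDerivAt.1 (hasGradientAt_convolution
        hu1.locallyIntegrable hw (ρ k) ?_)).hasFDerivWithinAt
      refine Metric.closedBall_subset_ball' ?_
      have := hρr k
      have := Metric.mem_ball.1 hx
      linarith
    · rw [← NNReal.coe_le_coe, coe_nnnorm, LinearIsometryEquiv.norm_map]
      exact norm_normed_convolution_le (ρ k) hM x
  have hlip : LipschitzOnWith M (K.indicator u) S := by
    refine LipschitzOnWith.of_dist_le_mul fun x hx y hy => ?_
    exact le_of_tendsto' (hx.2.dist hy.2) fun k => (hlipk k).dist_le_mul x hx.1 y hy.1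
  obtain ⟨v, hv, hvS⟩ := hlip.extend_real
  refine ⟨M, v, hv, ?_⟩
  have hae := ContDiffBump.ae_convolution_tendsto_right_of_locallyIntegrable (μ := volume) hρ0
    (Eventually.of_forall hρ2) hu1.locallyIntegrable
  filter_upwards [ae_restrict_of_ae hae, ae_restrict_mem Metric.isOpen_ball.measurableSet]
    with x hx hxb
  rw [← hvS ⟨hxb, hx⟩, Set.indicator_of_mem]
  exact hUK (Metric.ball_subset_ball (by linarith) hxb)

/-- Uniqueness of the weak gradient, when the function is locally equal to a Lipschitz function. -/
theorem HasWeakGradient.ae_eq_gradient {Ω U : Set (E n)} {u v : E n → ℝ} {G : E n → E n}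
    (h : HasWeakGradient Ω u G) (hU : IsOpen U) (hUΩ : U ⊆ Ω) {C : NNReal}
    (hv : LipschitzWith C v) (hvu : v =ᵐ[volume.restrict U] u) :
    G =ᵐ[volume.restrict U] gradient v := by
  have hgv : MemLpLoc 1 Set.univ (gradient v) := fun K hK _ => by
    refine memLp_one_iff_integrable.2 (Measure.integrableOn_of_bounded (M := C)
      hK.measure_lt_top.ne (measurable_gradient v).aestronglyMeasurable
      (Eventually.of_forall (norm_gradient_le hv)))
  have hloc : LocallyIntegrableOn (fun x => G x - gradient v x) U volume := by
    rw [locallyIntegrableOn_iff hU.isLocallyClosed]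
    intro K hKU hK
    exact (memLp_one_iff_integrable.1 (h.locInt_grad K hK (hKU.trans hUΩ))).sub
      (memLp_one_iff_integrable.1 (hgv K hK (Set.subset_univ _)))
  have := hU.ae_eq_zero_of_integral_contDiff_smul_eq_zero hloc fun g hg hgc hgU => by
    have hgΩ := hgU.trans hUΩ
    obtain ⟨D, hD⟩ := hg.lipschitzWith_of_hasCompactSupport hgc (by simp)
    simp_rw [smul_sub]
    rw [integral_sub (h.locInt_grad.integrable_smul hg.continuous hgc hgΩ)
      (hgv.integrable_smul hg.continuous hgc (Set.subset_univ _)), sub_eq_zero]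
    have h1 := h.integral_eq g ⟨hg, hgc, hgΩ⟩
    rw [setIntegral_smul_gradient hgΩ, setIntegral_eq_integral_of_forall_compl_eq_zero
      fun x hx => by
        rw [gradient_eq_zero_of_notMem_tsupport fun h => hx (hgΩ h), smul_zero]] at h1
    have h2 := integral_smul_gradient_eq_neg hv hD hgc
    rw [← neg_inj, ← h1, ← h2]
    refine integral_congr_ae ?_
    rw [EventuallyEq, ae_restrict_iff' hU.measurableSet] at hvu
    filter_upwards [hvu] with x hx
    by_cases hxU : x ∈ U
    · rw [hx hxU]
    · rw [gradient_eq_zero_of_notMem_tsupport fun h => hxU (hgU h), smul_zero, smul_zero]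
  rw [EventuallyEq, ae_restrict_iff' hU.measurableSet]
  filter_upwards [this] with x hx hxU using sub_eq_zero.1 (hx hxU)

/-! ### Lipschitz test functions. -/

/-- A weak inequality tested with smooth functions may be tested with Lipschitz functions. -/
theorem integral_le_integral_inner_gradient_of_lipschitz {U : Set (E n)} (hU : IsOpen U)
    {A : E n → E n} (hA : AEStronglyMeasurable A volume) {M : ℝ} (hM : ∀ x, ‖A x‖ ≤ M)
    {h : E n → ℝ} (hh : MemLpLoc 1 U h)
    (hw : ∀ ψ : E n → ℝ, IsTestFunction U ψ → (∀ x, 0 ≤ ψ x) →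
      ∫ x, ψ x * h x ≤ ∫ x, inner ℝ (A x) (gradient ψ x))
    {w : E n → ℝ} {C : NNReal} (hwl : LipschitzWith C w) (hw0 : ∀ x, 0 ≤ w x)
    (hwc : HasCompactSupport w) (hwU : tsupport w ⊆ U) :
    ∫ x, w x * h x ≤ ∫ x, inner ℝ (A x) (gradient w x) := by
  obtain ⟨δ, hδ, hδU⟩ := IsCompact.exists_cthickening_subset_open hwc hU hwU
  set L := Metric.cthickening δ (tsupport w) with hL
  have hLc : IsCompact L := IsCompact.cthickening hwc
  obtain ⟨ρ, hρ0, hρ2, hρδ⟩ := exists_bump_seq (n := n) hδ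
  -- Mollifying w keeps it nonnegative and supported in the compact L. The values converge
  -- everywhere and the gradients almost everywhere, with uniform bounds B and C, so dominated
  -- convergence handles both integrals.
  set ψ : ℕ → E n → ℝ := fun k =>
    ((ρ k).normed volume ⋆[ContinuousLinearMap.lsmul ℝ ℝ, volume] w) with hψ
  have hwi : LocallyIntegrable w volume := hwl.continuous.locallyIntegrable
  have hsupp : ∀ k, tsupport (ψ k) ⊆ L := fun k => by
    refine closure_minimal (fun z hz => ?_) Metric.isClosed_cthickening
    obtain ⟨y, hy, t, ht, rfl⟩ := support_convolution_subset _ hz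
    rw [(ρ k).support_normed_eq, mem_ball_zero_iff] at hy
    refine Metric.mem_cthickening_of_dist_le _ t _ _ (subset_tsupport _ ht) ?_
    rw [dist_eq_norm, add_sub_cancel_right]
    exact (hy.trans (hρδ k)).le
  have hψt : ∀ k, IsTestFunction U (ψ k) := fun k =>
    ⟨(ρ k).hasCompactSupport_normed.contDiff_convolution_left _ (ρ k).contDiff_normed hwi,
      hLc.of_isClosed_subset (isClosed_tsupport _) (hsupp k), (hsupp k).trans hδU⟩
  have hψ0 : ∀ k x, 0 ≤ ψ k x := fun k x =>
    integral_nonneg fun t => mul_nonneg ((ρ k).nonneg_normed t) (hw0 _)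
  have hgrad : ∀ k x, gradient (ψ k) x =
      ((ρ k).normed volume ⋆[ContinuousLinearMap.lsmul ℝ ℝ, volume] gradient w) x := fun k x =>
    (hasGradientAt_convolution (U := Set.univ) hwi (fun g hg => by
      obtain ⟨D, hD⟩ := hg.smooth.lipschitzWith_of_hasCompactSupport hg.compact (by simp)
      rw [setIntegral_univ, setIntegral_univ, integral_smul_gradient_eq_neg hwl hD hg.compact])
      (ρ k) (Set.subset_univ _)).gradient
  have hgi : LocallyIntegrable (gradient w) volume :=
    (memLp_top_of_bound (measurable_gradient w).aestronglyMeasurable C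
      (Eventually.of_forall (norm_gradient_le hwl))).locallyIntegrable le_top
  obtain ⟨B, hB⟩ := hwl.continuous.bounded_above_of_compact_support hwc
  have hB0 : 0 ≤ B := (norm_nonneg _).trans (hB 0)
  have hM0 : 0 ≤ M := (norm_nonneg _).trans (hM 0)
  have hhL : IntegrableOn h L volume := memLp_one_iff_integrable.1 (hh L hLc hδU)
  have T1 : Tendsto (fun k => ∫ x, ψ k x * h x) atTop (𝓝 (∫ x, w x * h x)) := by
    refine tendsto_integral_of_dominated_convergence (L.indicator fun x => B * ‖h x‖) ?_ ?_ ?_ ?_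
    · intro k
      exact (hh.integrable_smul (hψt k).smooth.continuous (hψt k).compact
        (hψt k).support_subset).aestronglyMeasurable
    · exact (integrable_indicator_iff hLc.measurableSet).2 (hhL.norm.const_mul B)
    · intro k
      refine Eventually.of_forall fun x => ?_
      by_cases hx : x ∈ L
      · rw [Set.indicator_of_mem hx, norm_mul]
        gcongr
        exact norm_normed_convolution_le (ρ k) (Eventually.of_forall hB) x
      · rw [image_eq_zero_of_notMem_tsupport fun h => hx (hsupp k h)]
        simp [hx]
    · refine Eventually.of_forall fun x => ?_
      exact (ContDiffBump.convolution_tendsto_right_of_continuous hρ0 hwl.continuous x).mul_const _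
  have T2 : Tendsto (fun k => ∫ x, inner ℝ (A x) (gradient (ψ k) x)) atTop
      (𝓝 (∫ x, inner ℝ (A x) (gradient w x))) := by
    refine tendsto_integral_of_dominated_convergence (L.indicator fun _ => M * C) ?_ ?_ ?_ ?_
    · exact fun k => hA.inner (measurable_gradient _).aestronglyMeasurable
    · exact (integrable_indicator_iff hLc.measurableSet).2
        (integrableOn_const hLc.measure_lt_top.ne)
    · intro k
      refine Eventually.of_forall fun x => ?_
      by_cases hx : x ∈ L
      · rw [Set.indicator_of_mem hx]
        refine (norm_inner_le_norm _ _).trans ?_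
        gcongr
        · exact hM x
        · rw [hgrad]
          exact norm_normed_convolution_le (ρ k) (Eventually.of_forall (norm_gradient_le hwl)) x
      · rw [gradient_eq_zero_of_notMem_tsupport fun h => hx (hsupp k h)]
        simp [hx]
    · filter_upwards [ContDiffBump.ae_convolution_tendsto_right_of_locallyIntegrable (μ := volume)
        hρ0 (Eventually.of_forall hρ2) hgi] with x hx
      simp_rw [hgrad]
      exact tendsto_const_nhds.inner hx
  exact le_of_tendsto_of_tendsto' T1 T2 fun k => hw (ψ k) (hψt k) (hψ0 k)

/-! ### Removing the contact point from the divergence inequality. -/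

theorem lipschitzWith_mul_of_bounded {χ w : E n → ℝ} {a C B : NNReal} (hχ : LipschitzWith a χ)
    (hχ1 : ∀ x, |χ x| ≤ 1) (hw : LipschitzWith C w) (hwB : ∀ x, |w x| ≤ B) :
    LipschitzWith (C + B * a) (fun x => χ x * w x) := by
  refine LipschitzWith.of_dist_le_mul fun x y => ?_
  have h1 := hχ.dist_le_mul x y
  have h2 := hw.dist_le_mul x y
  rw [Real.dist_eq] at h1 h2 ⊢
  calc |χ x * w x - χ y * w y| = |χ x * (w x - w y) + w y * (χ x - χ y)| := by ring_nf
    _ ≤ |χ x| * |w x - w y| + |w y| * |χ x - χ y| := by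
      rw [← abs_mul, ← abs_mul]; exact abs_add_le _ _
    _ ≤ 1 * (C * dist x y) + B * (a * dist x y) := by
      gcongr
      · exact hχ1 x
      · exact hwB y
    _ = ↑(C + B * a) * dist x y := by push_cast; ring

/-- A Lipschitz cutoff vanishing near `x₀`. -/
def pointCutoff (x₀ : E n) (k : ℕ) (x : E n) : ℝ := max 0 (min 1 ((k + 1) * ‖x - x₀‖ - 1))

theorem lipschitzWith_pointCutoff (x₀ : E n) (k : ℕ) :
    LipschitzWith ((k : NNReal) + 1) (pointCutoff x₀ k) := by
  have h : LipschitzWith ((k : NNReal) + 1) (fun x : E n => (k + 1 : ℝ) * ‖x - x₀‖ - 1) := by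
    refine LipschitzWith.of_dist_le_mul fun x y => ?_
    rw [Real.dist_eq, dist_eq_norm]
    have h1 := abs_norm_sub_norm_le (x - x₀) (y - x₀)
    rw [sub_sub_sub_cancel_right] at h1
    rw [show (k + 1 : ℝ) * ‖x - x₀‖ - 1 - ((k + 1) * ‖y - x₀‖ - 1) =
      (k + 1) * (‖x - x₀‖ - ‖y - x₀‖) by ring, abs_mul, abs_of_nonneg (by positivity)]
    push_cast
    gcongr
  exact (h.const_min 1).const_max 0

theorem pointCutoff_nonneg (x₀ : E n) (k : ℕ) (x : E n) : 0 ≤ pointCutoff x₀ k x :=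
  le_max_left _ _

theorem pointCutoff_le_one (x₀ : E n) (k : ℕ) (x : E n) : pointCutoff x₀ k x ≤ 1 :=
  max_le zero_le_one (min_le_left _ _)

theorem abs_pointCutoff_le_one (x₀ : E n) (k : ℕ) (x : E n) : |pointCutoff x₀ k x| ≤ 1 :=
  (abs_of_nonneg (pointCutoff_nonneg x₀ k x)).trans_le (pointCutoff_le_one x₀ k x)

theorem notMem_tsupport_pointCutoff (x₀ : E n) (k : ℕ) : x₀ ∉ tsupport (pointCutoff x₀ k) := by
  rw [notMem_tsupport_iff_eventuallyEq]
  filter_upwards [Metric.ball_mem_nhds x₀ (show (0 : ℝ) < 1 / (k + 1) by positivity)] with x hx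
  rw [Metric.mem_ball, dist_eq_norm, lt_div_iff₀ (by positivity)] at hx
  exact max_eq_left ((min_le_right _ _).trans (by linarith))

theorem pointCutoff_eq_one {x₀ x : E n} {k : ℕ} (hx : 2 / (k + 1) ≤ ‖x - x₀‖) :
    pointCutoff x₀ k x = 1 := by
  rw [div_le_iff₀ (by positivity)] at hx
  rw [pointCutoff, min_eq_left (by linarith), max_eq_right zero_le_one]

theorem gradient_pointCutoff_eq_zero {x₀ x : E n} {k : ℕ}
    (hx : x ∉ Metric.closedBall x₀ (2 / (k + 1))) : gradient (pointCutoff x₀ k) x = 0 := by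
  rw [Metric.mem_closedBall, dist_eq_norm, not_le] at hx
  have : IsLocalMax (pointCutoff x₀ k) x := Eventually.of_forall fun y => by
    rw [pointCutoff_eq_one hx.le]
    exact pointCutoff_le_one x₀ k y
  rw [gradient, this.fderiv_eq_zero, map_zero]

theorem gradient_mul {χ w : E n → ℝ} {x : E n} (hχ : DifferentiableAt ℝ χ x)
    (hw : DifferentiableAt ℝ w x) :
    gradient (fun y => χ y * w y) x = χ x • gradient w x + w x • gradient χ x := by
  rw [gradient, fderiv_fun_mul hχ hw, map_add]
  simp [gradient]

theorem tendsto_pointCutoff {x₀ x : E n} (hx : x ≠ x₀) :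
    Tendsto (fun k => pointCutoff x₀ k x) atTop (𝓝 1) := by
  have h0 : 0 < ‖x - x₀‖ := norm_pos_iff.2 (sub_ne_zero.2 hx)
  have h1 : Tendsto (fun k : ℕ => 2 / ((k : ℝ) + 1)) atTop (𝓝 0) := by
    have := (tendsto_one_div_add_atTop_nhds_zero_nat (𝕜 := ℝ)).const_mul 2
    simpa [div_eq_mul_inv] using this
  refine tendsto_const_nhds.congr' ?_
  filter_upwards [h1.eventually (eventually_le_nhds h0)] with k hk
  exact (pointCutoff_eq_one hk).symm

/-- A one-sided bound on the divergence off a point yields the weak inequality across that point,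
provided that the vector field is continuous there. -/
theorem integral_inner_gradient_le_of_divergence (hn : 1 ≤ n) {U : Set (E n)} (hU : IsOpen U)
    {x₀ : E n} {V : E n → E n} (hV : Continuous V) (hV1 : ContDiffOn ℝ 1 V (U \ {x₀})) {c : ℝ}
    (hc : ∀ x ∈ U \ {x₀}, -divergence V x ≤ c) {w : E n → ℝ} {C : NNReal}
    (hwl : LipschitzWith C w) (hw0 : ∀ x, 0 ≤ w x) (hwc : HasCompactSupport w)
    (hwU : tsupport w ⊆ U) :
    ∫ x, inner ℝ (V x) (gradient w x) ≤ c * ∫ x, w x := by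
  obtain ⟨m, rfl⟩ : ∃ m, n = m + 1 := ⟨n - 1, by omega⟩
  obtain ⟨B', hB'⟩ := hwl.continuous.bounded_above_of_compact_support hwc
  obtain ⟨B, rfl⟩ : ∃ B : NNReal, (B : ℝ) = B' := ⟨⟨B', (norm_nonneg _).trans (hB' 0)⟩, rfl⟩
  -- Subtracting the constant V(x₀) changes neither the divergence nor the integral, as ∫∇w = 0. It
  -- makes the field small near x₀, which is indispensable in dimension one, where the volume of the
  -- ball only just compensates the gradient of the cutoff.
  set W : E (m + 1) → E (m + 1) := fun x => V x - V x₀ with hW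
  have hWc : Continuous W := hV.sub continuous_const
  have hU' : IsOpen (U \ {x₀}) := hU.sdiff isClosed_singleton
  have hWd : ContDiffOn ℝ 1 W (U \ {x₀}) := hV1.sub contDiffOn_const
  have hdivW : ∀ x, divergence W x = divergence V x := fun x => by
    simp only [divergence, hW, fderiv_sub_const]
  have hIW : Integrable (fun x => inner ℝ (W x) (gradient w x)) volume := by
    obtain ⟨D, hD⟩ := IsCompact.bddAbove_image hwc hWc.norm.continuousOn
    refine integrable_of_bound_of_compact (K := tsupport w) (C := D * C)
      (hWc.aestronglyMeasurable.inner (measurable_gradient w).aestronglyMeasurable) hwc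
      (fun x hx => ?_) fun x hx => by
        rw [gradient_eq_zero_of_notMem_tsupport hx, inner_zero_right]
    have h1 : ‖W x‖ ≤ D := hD ⟨x, hx, rfl⟩
    exact (norm_inner_le_norm _ _).trans
      (mul_le_mul h1 (norm_gradient_le hwl x) (norm_nonneg _) ((norm_nonneg _).trans h1))
  have hIw : Integrable w volume := hwl.continuous.integrable_of_hasCompactSupport hwc
  have hVW : ∫ x, inner ℝ (V x) (gradient w x) = ∫ x, inner ℝ (W x) (gradient w x) := by
    have h1 : Integrable (gradient w) volume := by
      refine integrable_of_bound_of_compact (measurable_gradient w).aestronglyMeasurable hwc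
        (fun x _ => norm_gradient_le hwl x) fun x hx => gradient_eq_zero_of_notMem_tsupport hx
    have h2 : ∫ x, inner ℝ (V x₀) (gradient w x) = 0 := by
      rw [integral_inner h1, integral_gradient_eq_zero hwl hwc, inner_zero_right]
    rw [← add_zero (∫ x, inner ℝ (W x) (gradient w x)), ← h2,
      ← integral_add hIW (h1.const_inner _)]
    simp [hW]
  set χ := pointCutoff x₀ with hχ
  have hχm : ∀ k, AEStronglyMeasurable (χ k) volume := fun k =>
    (lipschitzWith_pointCutoff x₀ k).continuous.aestronglyMeasurable
  have hae : ∀ᵐ x : E (m + 1), x ≠ x₀ := by simp [ae_iff, measure_singleton]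
  have hIk : ∀ k, Integrable (fun x => χ k x * inner ℝ (W x) (gradient w x)) volume := fun k =>
    hIW.bdd_mul (c := 1) (hχm k) (Eventually.of_forall (abs_pointCutoff_le_one x₀ k))
  have hIwk : ∀ k, Integrable (fun x => χ k x * w x) volume := fun k =>
    hIw.bdd_mul (c := 1) (hχm k) (Eventually.of_forall (abs_pointCutoff_le_one x₀ k))
  have T1 : Tendsto (fun k => ∫ x, χ k x * inner ℝ (W x) (gradient w x)) atTop
      (𝓝 (∫ x, inner ℝ (W x) (gradient w x))) := by
    refine tendsto_integral_of_dominated_convergence _ (fun k => (hIk k).aestronglyMeasurable)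
      hIW.norm (fun k => Eventually.of_forall fun x => ?_) ?_
    · rw [norm_mul]
      exact mul_le_of_le_one_left (norm_nonneg _) (abs_pointCutoff_le_one x₀ k x)
    · filter_upwards [hae] with x hx
      simpa using (tendsto_pointCutoff hx).mul_const (inner ℝ (W x) (gradient w x))
  have T2 : Tendsto (fun k => ∫ x, χ k x * w x) atTop (𝓝 (∫ x, w x)) := by
    refine tendsto_integral_of_dominated_convergence _ (fun k => (hIwk k).aestronglyMeasurable)
      hIw.norm (fun k => Eventually.of_forall fun x => ?_) ?_
    · rw [norm_mul]
      exact mul_le_of_le_one_left (norm_nonneg _) (abs_pointCutoff_le_one x₀ k x)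
    · filter_upwards [hae] with x hx
      simpa using (tendsto_pointCutoff hx).mul_const (w x)
  -- The cutoff error is ∫ w⟨W, ∇χ_k⟩, carried by a ball of radius 2/(k+1). There w ≤ B, |W| ≤ η and
  -- |∇χ_k| ≤ k+1, so it is at most B·η·(k+1)·(2/(k+1))^{m+1} times the volume of the unit ball,
  -- hence at most Q·η.
  set Q : ℝ := B * (2 ^ (m + 1) * volume.real (Metric.ball (0 : E (m + 1)) 1)) with hQ
  have hQ0 : 0 ≤ Q := by positivity
  have main : ∀ η > 0, ∀ᶠ k : ℕ in atTop,
      ∫ x, χ k x * inner ℝ (W x) (gradient w x) ≤ c * (∫ x, χ k x * w x) + Q * η := by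
    intro η hη
    have hWη : ∀ᶠ r in 𝓝 (0 : ℝ), ∀ x ∈ Metric.closedBall x₀ r, ‖W x‖ ≤ η := by
      have h1 : ∀ᶠ x in 𝓝 x₀, ‖W x‖ < η := by
        have : Tendsto W (𝓝 x₀) (𝓝 0) := by simpa [hW] using hWc.tendsto x₀
        exact this.norm.eventually (by simpa using gt_mem_nhds hη)
      obtain ⟨r, hr, hr'⟩ := Metric.eventually_nhds_iff_ball.1 h1
      filter_upwards [gt_mem_nhds hr] with s hs x hx
      exact (hr' x (Metric.closedBall_subset_ball hs hx)).le
    have h1 : Tendsto (fun k : ℕ => 2 / ((k : ℝ) + 1)) atTop (𝓝 0) := by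
      have := (tendsto_one_div_add_atTop_nhds_zero_nat (𝕜 := ℝ)).const_mul 2
      simpa [div_eq_mul_inv] using this
    filter_upwards [h1.eventually hWη] with k hk
    set g : E (m + 1) → ℝ := fun x => χ k x * w x with hg
    have hgl := lipschitzWith_mul_of_bounded (lipschitzWith_pointCutoff x₀ k)
      (abs_pointCutoff_le_one x₀ k) hwl hB'
    have hgc : HasCompactSupport g := hwc.mul_left
    have hgU : tsupport g ⊆ U \ {x₀} := fun x hx => by
      refine ⟨hwU (closure_mono (Function.support_mul_subset_right _ _) hx), ?_⟩
      rintro rfl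
      exact notMem_tsupport_pointCutoff x k
        (closure_mono (Function.support_mul_subset_left _ _) hx)
    obtain ⟨hI, hdiv⟩ := integral_inner_gradient_eq_neg_divergence hU' hWd hgl hgc hgU
    have h2 : - ∫ x, divergence W x * g x ≤ c * ∫ x, g x := by
      rw [← integral_neg, ← integral_const_mul]
      refine integral_mono hI.neg ((hIwk k).const_mul c) fun x => ?_
      by_cases hx : x ∈ U \ {x₀}
      · have h3 := hc x hx
        have h4 : 0 ≤ g x := mul_nonneg (pointCutoff_nonneg x₀ k x) (hw0 x)
        simp only [hdivW]
        nlinarith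
      · simp [image_eq_zero_of_notMem_tsupport fun h => hx (hgU h)]
    set R : E (m + 1) → ℝ := fun x => w x * inner ℝ (W x) (gradient (χ k) x) with hR
    have hgrad : ∀ᵐ x, inner ℝ (W x) (gradient g x) =
        χ k x * inner ℝ (W x) (gradient w x) + R x := by
      filter_upwards [hwl.ae_differentiableAt (μ := volume),
        (lipschitzWith_pointCutoff x₀ k).ae_differentiableAt (μ := volume)] with x hx1 hx2
      rw [hg, gradient_mul hx2 hx1, inner_add_right, inner_smul_right, inner_smul_right]
    have hR0 : ∀ x ∉ Metric.closedBall x₀ (2 / ((k : ℝ) + 1)), R x = 0 := fun x hx => by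
      simp only [hR, hχ, gradient_pointCutoff_eq_zero hx, inner_zero_right, mul_zero]
    have hRb : ∀ x ∈ Metric.closedBall x₀ (2 / ((k : ℝ) + 1)), ‖R x‖ ≤ B * (η * (k + 1)) := by
      intro x hx
      rw [hR, norm_mul]
      have h3 : ‖gradient (χ k) x‖ ≤ k + 1 := by
        simpa using norm_gradient_le (lipschitzWith_pointCutoff x₀ k) x
      have h4 : ‖inner ℝ (W x) (gradient (χ k) x)‖ ≤ η * (k + 1) :=
        (norm_inner_le_norm _ _).trans
          (mul_le_mul (hk x hx) h3 (norm_nonneg _) hη.le)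
      exact mul_le_mul (hB' x) h4 (norm_nonneg _) B.2
    have hRI : Integrable R volume := integrable_of_bound_of_compact
      (hwl.continuous.aestronglyMeasurable.mul
        (hWc.aestronglyMeasurable.inner (measurable_gradient _).aestronglyMeasurable))
      (isCompact_closedBall x₀ _) hRb hR0
    have hRint : ‖∫ x, R x‖ ≤ Q * η := by
      rw [← setIntegral_eq_integral_of_forall_compl_eq_zero hR0]
      refine (norm_setIntegral_le_of_norm_le_const
        (isCompact_closedBall x₀ _).measure_lt_top hRb).trans ?_
      rw [Measure.addHaar_real_closedBall _ _ (by positivity), finrank_euclideanSpace_fin]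
      have h5 : (k + 1 : ℝ) * (2 / (k + 1)) ^ (m + 1) ≤ 2 ^ (m + 1) := by
        have h6 : (1 : ℝ) ≤ (k + 1) ^ m := one_le_pow₀ (by linarith [(Nat.cast_nonneg k : (0:ℝ) ≤ k)])
        have h7 : (k + 1 : ℝ) * (2 / (k + 1)) ^ (m + 1) = 2 ^ (m + 1) / (k + 1) ^ m := by
          rw [div_pow, pow_succ ((k : ℝ) + 1) m]
          field_simp
        rw [h7]
        exact div_le_self (by positivity) h6
      calc B * (η * (k + 1)) * ((2 / (k + 1)) ^ (m + 1) *
            volume.real (Metric.ball (0 : E (m + 1)) 1))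
          = B * η * volume.real (Metric.ball (0 : E (m + 1)) 1) *
            ((k + 1 : ℝ) * (2 / (k + 1)) ^ (m + 1)) := by ring
        _ ≤ B * η * volume.real (Metric.ball (0 : E (m + 1)) 1) * 2 ^ (m + 1) := by gcongr
        _ = Q * η := by rw [hQ]; ring
    rw [integral_congr_ae hgrad, integral_add (hIk k) hRI] at hdiv
    have h8 := (abs_le.1 hRint).1
    linarith
  rw [hVW]
  refine le_of_forall_pos_le_add fun ε hε => ?_
  have hη : 0 < ε / (Q + 1) := by positivity
  have h1 : ∫ x, inner ℝ (W x) (gradient w x) ≤ c * (∫ x, w x) + Q * (ε / (Q + 1)) :=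
    le_of_tendsto_of_tendsto T1 ((T2.const_mul c).add_const _) (main _ hη)
  have h2 : Q * (ε / (Q + 1)) ≤ ε := by
    rw [mul_div_assoc', div_le_iff₀ (by positivity)]
    nlinarith
  linarith

/-! ### Perturbing a test function. -/

theorem contDiff_gradient {φ : E n → ℝ} (hφ : ContDiff ℝ 2 φ) : ContDiff ℝ 1 (gradient φ) := by
  rw [contDiff_euclidean]
  intro i
  simp_rw [gradient_apply]
  exact (hφ.fderiv_right (m := 1) (by norm_num)).clm_apply contDiff_const

theorem gradient_add_const_mul {φ ζ : E n → ℝ} (hφ : Differentiable ℝ φ) (hζ : Differentiable ℝ ζ)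
    (m : ℝ) (x : E n) :
    gradient (fun y => φ y + m * ζ y) x = gradient φ x + m • gradient ζ x := by
  rw [gradient, fderiv_fun_add (hφ x) ((hζ x).const_mul m), fderiv_const_mul (hζ x), map_add]
  simp [gradient]

theorem pLaplacian_congr {p : ℝ} {φ ψ : E n → ℝ} {x : E n}
    (h : gradient φ =ᶠ[𝓝 x] gradient ψ) : pLaplacian p φ x = pLaplacian p ψ x := by
  have : (fun y => flux p (gradient φ y)) =ᶠ[𝓝 x] fun y => flux p (gradient ψ y) :=
    h.mono fun y hy => by simp only [hy]
  simp only [pLaplacian, divergence, this.fderiv_eq]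

/-- Where the gradient does not vanish, `Δ_p (φ + m ζ)` depends continuously on `m` and on the
point. -/
theorem continuousAt_pLaplacian_add_const_mul (p : ℝ) {φ ζ : E n → ℝ} (hφ : ContDiff ℝ 2 φ)
    (hζ : ContDiff ℝ 2 ζ) {y : E n} (hy : gradient φ y ≠ 0) :
    ContinuousAt (fun z : ℝ × E n => pLaplacian p (fun x => φ x + z.1 * ζ x) z.2) (0, y) := by
  have hgφ := contDiff_gradient hφ
  have hgζ := contDiff_gradient hζ
  have hgr : ∀ (m : ℝ) (x : E n), gradient (fun y => φ y + m * ζ y) x =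
      gradient φ x + m • gradient ζ x := gradient_add_const_mul
    (hφ.differentiable two_ne_zero) (hζ.differentiable two_ne_zero)
  set Φ : ℝ × E n → E n := fun z => gradient φ z.2 + z.1 • gradient ζ z.2 with hΦ
  have hΦc : Continuous Φ := by
    have h1 := hgφ.continuous
    have h2 := hgζ.continuous
    fun_prop
  have hΦ0 : Φ (0, y) ≠ 0 := by simpa [hΦ] using hy
  set D : ℝ × E n → (E n →L[ℝ] E n) := fun z =>
    fderiv ℝ (gradient φ) z.2 + z.1 • fderiv ℝ (gradient ζ) z.2 with hD
  have hDc : Continuous D := by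
    have h1 := hgφ.continuous_fderiv one_ne_zero
    have h2 := hgζ.continuous_fderiv one_ne_zero
    fun_prop
  -- Near (0, y) the perturbed gradient Φ stays away from 0, where the flux is C¹. The chain rule
  -- then gives Δ_p as the trace of a composition depending continuously on z.
  have hformula : (fun z : ℝ × E n => ∑ i : Fin n,
      (fderiv ℝ (flux p) (Φ z) (D z (EuclideanSpace.single i 1))) i) =ᶠ[𝓝 (0, y)]
      fun z : ℝ × E n => pLaplacian p (fun x => φ x + z.1 * ζ x) z.2 := by
    filter_upwards [hΦc.continuousAt.eventually_ne hΦ0] with z hz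
    have h1 : HasFDerivAt (fun x => gradient (fun y => φ y + z.1 * ζ y) x) (D z) z.2 := by
      simp_rw [hgr]
      exact (hgφ.differentiable one_ne_zero _).hasFDerivAt.add
        ((hgζ.differentiable one_ne_zero _).hasFDerivAt.const_smul z.1)
    have h2 : HasFDerivAt (flux p) (fderiv ℝ (flux p) (Φ z))
        (gradient (fun y => φ y + z.1 * ζ y) z.2) := by
      rw [hgr]
      exact ((contDiffAt_flux p hz).differentiableAt one_ne_zero).hasFDerivAt
    have h3 : HasFDerivAt (fun x => flux p (gradient (fun y => φ y + z.1 * ζ y) x)) _ z.2 :=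
      h2.comp z.2 h1
    simp only [pLaplacian, divergence, h3.fderiv]
    rfl
  refine ContinuousAt.congr ?_ hformula
  have hfl : ContinuousAt (fun z => fderiv ℝ (flux p) (Φ z)) (0, y) := by
    have h1 : ContinuousAt (fderiv ℝ (flux p)) (Φ (0, y)) :=
      ((contDiffAt_flux p hΦ0).fderiv_right (m := 0) (by norm_num)).continuousAt
    exact h1.comp hΦc.continuousAt
  refine tendsto_finsetSum _ fun i _ => ?_
  have h4 : ContinuousAt (fun z => fderiv ℝ (flux p) (Φ z) (D z (EuclideanSpace.single i 1)))
      (0, y) := hfl.clm_apply (hDc.clm_apply continuous_const).continuousAt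
  exact (EuclideanSpace.proj i : E n →L[ℝ] ℝ).continuous.continuousAt.comp h4

/-- Adding a small multiple of a function which is constant near `x₀` preserves strict differential
inequalities off `x₀`. -/
theorem eventually_pLaplacian_add_const_mul_lt {p : ℝ} {φ ζ : E n → ℝ} (hφ : ContDiff ℝ 2 φ)
    (hζ : ContDiff ℝ 2 ζ) {x₀ : E n} {s r : ℝ} (hζ1 : ∀ x ∈ Metric.ball x₀ s, gradient ζ x = 0)
    (hgr : ∀ x ∈ Metric.closedBall x₀ r, x ≠ x₀ → gradient φ x ≠ 0) {c c' : ℝ} (hcc' : c < c')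
    (hs : 0 < s)
    (hc : ∀ x ∈ Metric.closedBall x₀ r, x ≠ x₀ → -pLaplacian p φ x ≤ c) :
    ∀ᶠ m in 𝓝 (0 : ℝ), ∀ x ∈ Metric.closedBall x₀ r, x ≠ x₀ →
      gradient φ x + m • gradient ζ x ≠ 0 ∧ -pLaplacian p (fun y => φ y + m * ζ y) x < c' := by
  -- Continuity of Δ_p is unavailable at x₀, where ∇φ may vanish. It is needed only on this compact
  -- set: on the removed ball ∇ζ = 0, so the perturbation changes nothing.
  have hK : IsCompact (Metric.closedBall x₀ r \ Metric.ball x₀ s) :=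
    (isCompact_closedBall _ _).diff Metric.isOpen_ball
  have h1 : ∀ᶠ m in 𝓝 (0 : ℝ), ∀ x ∈ Metric.closedBall x₀ r \ Metric.ball x₀ s,
      gradient φ x + m • gradient ζ x ≠ 0 ∧ -pLaplacian p (fun y => φ y + m * ζ y) x < c' := by
    refine hK.eventually_forall_of_forall_eventually fun y hy => ?_
    have hyx : y ≠ x₀ := by
      rintro rfl
      exact hy.2 (Metric.mem_ball_self hs)
    have hg := hgr y hy.1 hyx
    refine Eventually.and ?_ ?_
    · have hc1 := (contDiff_gradient hφ).continuous
      have hc2 := (contDiff_gradient hζ).continuous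
      have : Continuous fun z : ℝ × E n => gradient φ z.2 + z.1 • gradient ζ z.2 := by fun_prop
      exact this.continuousAt.eventually_ne (by simpa using hg)
    · refine (continuousAt_pLaplacian_add_const_mul p hφ hζ hg).neg.eventually_lt_const ?_
      simpa using (hc y hy.1 hyx).trans_lt hcc'
  filter_upwards [h1] with m hm x hx hxx
  by_cases hxs : x ∈ Metric.ball x₀ s
  · refine ⟨by simpa [hζ1 x hxs] using hgr x hx hxx, ?_⟩
    rw [pLaplacian_congr (ψ := φ)]
    · exact (hc x hx hxx).trans_lt hcc'
    · filter_upwards [Metric.isOpen_ball.mem_nhds hxs] with y hy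
      rw [gradient_add_const_mul (hφ.differentiable two_ne_zero) (hζ.differentiable two_ne_zero),
        hζ1 y hy, smul_zero, add_zero]
  · exact hm x ⟨hx, hxs⟩

/-! ### The comparison argument. -/

/-- Comparison: a Lipschitz weak supersolution cannot be touched from below by a strict classical
subsolution off the contact point. -/
theorem false_of_touching_of_strict (hn : 1 ≤ n) {p : ℝ} (hp : 1 < p) {f : E n → ℝ → E n → ℝ}
    {x₀ : E n} {R : ℝ} (hR : 0 < R)
    (hf : ContinuousOn (fun z : E n × ℝ × E n => f z.1 z.2.1 z.2.2)
      (Metric.closedBall x₀ R ×ˢ Set.univ))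
    {v φ : E n → ℝ} {M : NNReal} (hv : LipschitzWith M v) (hφ : ContDiff ℝ 2 φ)
    (hφc : HasCompactSupport φ) (hx₀ : v x₀ = φ x₀) (hle : ∀ x, φ x ≤ v x)
    (hgr : ∀ x ∈ Metric.closedBall x₀ R, x ≠ x₀ → gradient φ x ≠ 0) {c : ℝ}
    (hc : ∀ x ∈ Metric.closedBall x₀ R, x ≠ x₀ → -pLaplacian p φ x ≤ c)
    (hcf : c < f x₀ (φ x₀) (gradient φ x₀))
    (hh : MemLpLoc 1 (Metric.ball x₀ R) (fun x => f x (v x) (gradient v x)))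
    (hw : ∀ ψ : E n → ℝ, IsTestFunction (Metric.ball x₀ R) ψ → (∀ x, 0 ≤ ψ x) →
      ∫ x, ψ x * f x (v x) (gradient v x) ≤
        ∫ x, inner ℝ (flux p (gradient v x)) (gradient ψ x)) : False := by
  have hgφ := (contDiff_gradient hφ).continuous
  -- A quarter of the gap: one δ pays for the continuity of f, one for the estimate with K, one for
  -- the perturbation of -Δ_p φ, and one remains for the contradiction.
  set δ : ℝ := (f x₀ (φ x₀) (gradient φ x₀) - c) / 4 with hδdef
  have hδ : 0 < δ := by rw [hδdef]; linarith
  obtain ⟨τ, hτ, hfτ⟩ : ∃ τ > 0, ∀ (x : E n) (s : ℝ) (η : E n), dist x x₀ < τ → |s| < τ → ‖η‖ < τ →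
      f x₀ (φ x₀) (gradient φ x₀) - δ < f x (φ x + s) (gradient φ x + η) := by
    have h1 : ContinuousAt (fun z : E n × ℝ × E n => f z.1 z.2.1 z.2.2)
        (x₀, φ x₀ + 0, gradient φ x₀ + 0) := by
      refine hf.continuousAt ?_
      exact prod_mem_nhds (Metric.closedBall_mem_nhds x₀ hR) univ_mem
    have h2 : Continuous fun z : E n × ℝ × E n => (z.1, φ z.1 + z.2.1, gradient φ z.1 + z.2.2) := by
      have := hφ.continuous
      fun_prop
    have h3 := ContinuousAt.comp (x := ((x₀, 0, 0) : E n × ℝ × E n)) h1 h2.continuousAt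
    have h4 := h3.eventually_const_lt (u := f x₀ (φ x₀) (gradient φ x₀) - δ) (by simp [hδ])
    obtain ⟨τ, hτ, h5⟩ := Metric.eventually_nhds_iff.1 h4
    refine ⟨τ, hτ, fun x s η hx hs hη => h5 (y := (x, s, η)) ?_⟩
    simp only [Prod.dist_eq, dist_zero_right, Real.norm_eq_abs]
    exact max_lt hx (max_lt hs hη)
  set r : ℝ := min (τ / 2) R with hrdef
  have hr : 0 < r := lt_min (by linarith) hR
  have hrτ : r < τ := (min_le_left _ _).trans_lt (by linarith)
  have hrR : r ≤ R := min_le_right _ _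
  let ζ : ContDiffBump x₀ := ⟨r / 4, r / 2, by linarith, by linarith⟩
  have hζ : ContDiff ℝ 2 ζ := ζ.contDiff
  have hζc : HasCompactSupport ζ := ζ.hasCompactSupport
  have hζ1 : ∀ x ∈ Metric.ball x₀ (r / 4), gradient ζ x = 0 := fun x hx => by
    rw [gradient, (ζ.eventuallyEq_one_of_mem_ball hx).fderiv_eq]
    simp
  obtain ⟨Cζ, hCζ⟩ := hζ.lipschitzWith_of_hasCompactSupport hζc two_ne_zero
  obtain ⟨Cφ, hCφ⟩ := hφ.lipschitzWith_of_hasCompactSupport hφc two_ne_zero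
  obtain ⟨S, hS⟩ := (isCompact_closedBall x₀ R).bddAbove_image hv.continuous.norm.continuousOn
  obtain ⟨K, hK0, hK⟩ := exists_sub_le_add_mul_inner_flux hp (isCompact_closedBall x₀ R) hf S
    (max (M : ℝ) (Cφ + Cζ)) hδ
  have hrsub : Metric.closedBall x₀ r ⊆ Metric.closedBall x₀ R :=
    Metric.closedBall_subset_closedBall hrR
  -- m < 1 keeps ∇φ_m within the bound for which K was chosen. The two conditions with τ keep v and
  -- ∇φ_m close to φ and ∇φ where w > 0, since there 0 ≤ v - φ < m. The condition K·m < 1 allows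
  -- absorption.
  obtain ⟨m, hm0, hm1, hmτ, hmζ, hmK, hmp⟩ : ∃ m : ℝ, 0 < m ∧ m < 1 ∧ m < τ ∧ m * Cζ < τ ∧
      K * m < 1 ∧ ∀ x ∈ Metric.closedBall x₀ r, x ≠ x₀ →
      gradient φ x + m • gradient ζ x ≠ 0 ∧
      -pLaplacian p (fun y => φ y + m * ζ y) x < c + δ := by
    have e1 := eventually_pLaplacian_add_const_mul_lt (p := p) hφ hζ hζ1
      (fun x hx => hgr x (hrsub hx)) (show c < c + δ by linarith) (by linarith)
      (fun x hx => hc x (hrsub hx))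
    have e2 : ∀ᶠ m in 𝓝 (0 : ℝ), m * Cζ < τ :=
      (continuous_id.mul continuous_const).continuousAt.eventually_lt_const (by simpa using hτ)
    have e3 : ∀ᶠ m in 𝓝 (0 : ℝ), K * m < 1 :=
      (continuous_const.mul continuous_id).continuousAt.eventually_lt_const (by simp)
    have e4 : ∀ᶠ m in 𝓝[>] (0 : ℝ), m < 1 ∧ m < τ ∧ m * Cζ < τ ∧ K * m < 1 ∧ _ :=
      ((gt_mem_nhds one_pos).and ((gt_mem_nhds hτ).and (e2.and (e3.and e1)))).filter_mono
        nhdsWithin_le_nhds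
    obtain ⟨m, h1, h2⟩ := (eventually_mem_nhdsWithin.and e4).exists
    exact ⟨m, h1, h2⟩
  set φm : E n → ℝ := fun y => φ y + m * ζ y with hφm
  have hφmd : ContDiff ℝ 2 φm := hφ.add (contDiff_const.mul hζ)
  have hgm : ∀ x, gradient φm x = gradient φ x + m • gradient ζ x :=
    gradient_add_const_mul (hφ.differentiable two_ne_zero) (hζ.differentiable two_ne_zero) m
  have hgmζ : ∀ x, ‖m • gradient ζ x‖ ≤ m * Cζ := fun x => by
    rw [norm_smul, Real.norm_of_nonneg hm0.le]
    exact mul_le_mul_of_nonneg_left (norm_gradient_le hCζ x) hm0.le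
  have hgmb : ∀ x, ‖gradient φm x‖ ≤ max (M : ℝ) (Cφ + Cζ) := fun x => by
    rw [hgm]
    refine (norm_add_le _ _).trans (le_max_of_le_right (add_le_add (norm_gradient_le hCφ x) ?_))
    exact (hgmζ x).trans (mul_le_of_le_one_left Cζ.2 hm1.le)
  have hgvb : ∀ x, ‖gradient v x‖ ≤ max (M : ℝ) (Cφ + Cζ) := fun x =>
    (norm_gradient_le hv x).trans (le_max_left _ _)
  set w : E n → ℝ := fun x => max (φm x - v x) 0 with hwdef
  have hφml : LipschitzWith (Cφ + ‖m‖₊ * Cζ) φm := by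
    refine hCφ.add ?_
    exact (lipschitzWith_smul m).comp hCζ
  obtain ⟨Cw, hwl⟩ : ∃ Cw, LipschitzWith Cw w := ⟨_, (hφml.sub hv).max_const 0⟩
  have hw0 : ∀ x, 0 ≤ w x := fun x => le_max_right _ _
  have hwm : ∀ x, w x ≤ m := fun x => by
    refine max_le ?_ hm0.le
    have h1 := hle x
    have h2 : m * ζ x ≤ m * 1 := mul_le_mul_of_nonneg_left ζ.le_one hm0.le
    simp only [hφm]
    linarith
  have hwsupp : tsupport w ⊆ Metric.closedBall x₀ (r / 2) := by
    refine closure_minimal (fun x hx => ?_) Metric.isClosed_closedBall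
    by_contra hxb
    refine hx (max_eq_right ?_)
    have h1 : ζ x = 0 := ζ.zero_of_le_dist (by
      rw [Metric.mem_closedBall, not_le] at hxb
      exact hxb.le)
    simp only [hφm, h1]
    linarith [hle x]
  have hwc : HasCompactSupport w :=
    (isCompact_closedBall x₀ (r / 2)).of_isClosed_subset (isClosed_tsupport _) hwsupp
  have hwr : tsupport w ⊆ Metric.ball x₀ r :=
    hwsupp.trans (Metric.closedBall_subset_ball (by linarith))
  have hwR : tsupport w ⊆ Metric.ball x₀ R := hwr.trans (Metric.ball_subset_ball hrR)
  set A : E n → E n := fun x => flux p (gradient v x) with hA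
  set V : E n → E n := fun x => flux p (gradient φm x) with hV
  have hAm : AEStronglyMeasurable A volume :=
    ((continuous_flux hp).measurable.comp (measurable_gradient v)).aestronglyMeasurable
  have hVc : Continuous V := (continuous_flux hp).comp (contDiff_gradient hφmd).continuous
  have hfluxb : ∀ {η : E n}, ‖η‖ ≤ max (M : ℝ) (Cφ + Cζ) →
      ‖flux p η‖ ≤ (max (M : ℝ) (Cφ + Cζ)) ^ (p - 1) := fun h => by
    rw [norm_flux hp]
    exact Real.rpow_le_rpow (norm_nonneg _) h (by linarith)
  have ineqA : ∫ x, w x * f x (v x) (gradient v x) ≤ ∫ x, inner ℝ (A x) (gradient w x) :=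
    integral_le_integral_inner_gradient_of_lipschitz Metric.isOpen_ball hAm
      (fun x => hfluxb (hgvb x)) hh hw hwl hw0 hwc hwR
  have ineqV : ∫ x, inner ℝ (V x) (gradient w x) ≤ (c + δ) * ∫ x, w x := by
    refine integral_inner_gradient_le_of_divergence hn Metric.isOpen_ball hVc (x₀ := x₀) ?_ ?_
      hwl hw0 hwc hwr
    · intro x hx
      have h1 : gradient φm x ≠ 0 := by
        rw [hgm]; exact (hmp x (Metric.ball_subset_closedBall hx.1) hx.2).1
      exact ((contDiffAt_flux p h1).comp x (contDiff_gradient hφmd).contDiffAt).contDiffWithinAt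
    · exact fun x hx => (hmp x (Metric.ball_subset_closedBall hx.1) hx.2).2.le
  have hIinner : ∀ X : E n → E n, AEStronglyMeasurable X volume →
      (∀ x, ‖X x‖ ≤ (max (M : ℝ) (Cφ + Cζ)) ^ (p - 1)) →
      Integrable (fun x => inner ℝ (X x) (gradient w x)) volume := fun X hX hXb => by
    refine integrable_of_bound_of_compact
      (C := (max (M : ℝ) (Cφ + Cζ)) ^ (p - 1) * Cw)
      (hX.inner (measurable_gradient w).aestronglyMeasurable)
      hwc (fun x _ => ?_) fun x hx => by
        rw [gradient_eq_zero_of_notMem_tsupport hx, inner_zero_right]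
    exact (norm_inner_le_norm _ _).trans
      (mul_le_mul (hXb x) (norm_gradient_le hwl x) (norm_nonneg _) ((norm_nonneg _).trans (hXb x)))
  have hIA := hIinner A hAm fun x => hfluxb (hgvb x)
  have hIV := hIinner V hVc.aestronglyMeasurable fun x => hfluxb (hgmb x)
  have hIf : Integrable (fun x => w x * f x (v x) (gradient v x)) volume :=
    hh.integrable_smul hwl.continuous hwc hwR
  have hIw : Integrable w volume := hwl.continuous.integrable_of_hasCompactSupport hwc
  -- Where w = 0, w is minimal and its gradient vanishes, so both sides are 0. Where w > 0,
  -- f(x,v,∇v) ≥ c + 2δ - K·D, and the loss K·w·D is at most D because K·w ≤ 1.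
  have hpt : ∀ᵐ x, δ * w x ≤ inner ℝ (V x) (gradient w x) - inner ℝ (A x) (gradient w x) +
      w x * f x (v x) (gradient v x) - (c + δ) * w x := by
    filter_upwards [hv.ae_differentiableAt (μ := volume)] with x hx
    rcases (hw0 x).eq_or_lt with h0 | h0
    · have hmin : IsLocalMin w x := Eventually.of_forall fun y => by rw [← h0]; exact hw0 y
      simp [gradient, hmin.fderiv_eq_zero, ← h0]
    · have hpos : 0 < φm x - v x := by
        by_contra h
        exact h0.ne' (max_eq_right (not_lt.1 h))
      have hwx : w x = φm x - v x := max_eq_left hpos.le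
      have hev : w =ᶠ[𝓝 x] fun y => φm y - v y := by
        have h1 : ContinuousAt (fun y => φm y - v y) x :=
          (hφmd.continuous.sub hv.continuous).continuousAt
        filter_upwards [h1.eventually_const_lt hpos] with y hy using max_eq_left hy.le
      have hgw : gradient w x = gradient φm x - gradient v x := by
        rw [gradient_congr hev, gradient,
          fderiv_fun_sub (hφmd.differentiable two_ne_zero x) hx, map_sub, gradient, gradient]
      have hxr : x ∈ Metric.closedBall x₀ r :=
        Metric.ball_subset_closedBall (hwr (subset_tsupport _ h0.ne'))
      have hxR := hrsub hxr
      have hD := hK x hxR (v x) (hS ⟨x, hxR, rfl⟩) _ _ (hgmb x) (hgvb x)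
      have hD0 := inner_flux_sub_nonneg hp (gradient φm x) (gradient v x)
      have hfx : f x₀ (φ x₀) (gradient φ x₀) - δ < f x (v x) (gradient φm x) := by
        have h1 := hfτ x (v x - φ x) (m • gradient ζ x)
          ((Metric.mem_closedBall.1 hxr).trans_lt hrτ) ?_ ((hgmζ x).trans_lt hmζ)
        · rwa [add_sub_cancel, ← hgm] at h1
        · rw [abs_of_nonneg (sub_nonneg.2 (hle x))]
          have h2 : m * ζ x ≤ m * 1 := mul_le_mul_of_nonneg_left ζ.le_one hm0.le
          simp only [hφm] at hpos
          linarith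
      rw [← inner_sub_left, hgw]
      change δ * w x ≤ inner ℝ (flux p (gradient φm x) - flux p (gradient v x))
        (gradient φm x - gradient v x) + _ - _
      set D : ℝ := inner ℝ (flux p (gradient φm x) - flux p (gradient v x))
        (gradient φm x - gradient v x)
      have hKw : K * w x ≤ 1 :=
        (mul_le_mul_of_nonneg_left (hwm x) hK0).trans hmK.le
      have h1 : K * w x * D ≤ D := mul_le_of_le_one_left hD0 hKw
      have h2 : c + 2 * δ - K * D ≤ f x (v x) (gradient v x) := by
        rw [hδdef] at *
        linarith
      have h3 := mul_le_mul_of_nonneg_left h2 h0.le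
      nlinarith
  -- By `ineqV` and `ineqA` the right-hand side integrates to something nonpositive, whereas ∫w > 0
  -- because w(x₀) = m.
  have hint := integral_mono_ae (hIw.const_mul δ)
    (((hIV.sub hIA).add hIf).sub (hIw.const_mul (c + δ))) hpt
  have hsplit : ∫ x, (inner ℝ (V x) (gradient w x) - inner ℝ (A x) (gradient w x) +
      w x * f x (v x) (gradient v x) - (c + δ) * w x) =
      (∫ x, inner ℝ (V x) (gradient w x)) - (∫ x, inner ℝ (A x) (gradient w x)) +
      (∫ x, w x * f x (v x) (gradient v x)) - (c + δ) * ∫ x, w x := by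
    refine (integral_sub ((hIV.sub hIA).add hIf) (hIw.const_mul (c + δ))).trans ?_
    rw [integral_const_mul]
    congr 1
    refine (integral_add (hIV.sub hIA) hIf).trans ?_
    congr 1
    exact integral_sub hIV hIA
  have hpos : 0 < ∫ x, w x := by
    refine hwl.continuous.integral_pos_of_hasCompactSupport_nonneg_nonzero hwc hw0 (x := x₀) ?_
    have h1 : ζ x₀ = 1 := ζ.one_of_mem_closedBall (Metric.mem_closedBall_self ζ.rIn_pos.le)
    simp only [hwdef, hφm, h1, hx₀]
    rw [max_eq_left (by linarith)]
    linarith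
  have hint' : δ * ∫ x, w x ≤ _ := (integral_const_mul δ w).symm.trans_le (hint.trans_eq hsplit)
  have := mul_pos hδ hpos
  linarith

/-! ### From weak supersolutions to viscosity supersolutions. -/

/-- A locally Lipschitz representative of a weak supersolution is a viscosity supersolution. -/
theorem IsWeakSupersolution.isViscositySupersolution (hn : 1 ≤ n) {Ω : Set (E n)} (hΩ : IsOpen Ω)
    (hΩne : Ω.Nonempty) {f : E n → ℝ → E n → ℝ}
    (hf : ContinuousOn (fun z : E n × ℝ × E n => f z.1 z.2.1 z.2.2) (Ω ×ˢ Set.univ))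
    {p : ℝ} (hp : 1 < p) {u v : E n → ℝ} (hu : IsWeakSupersolution Ω p f u)
    (hv : ContinuousOn v Ω) (hvu : v =ᵐ[volume.restrict Ω] u)
    (hloc : ∀ a ∈ Ω, ∃ r > 0, ∃ (C : NNReal) (v' : E n → ℝ), LipschitzWith C v' ∧
      Set.EqOn v' v (Metric.ball a r)) :
    IsViscositySupersolution Ω p f (fun x => (v x : EReal)) where
  lsc := (continuous_coe_real_ereal.comp_continuousOn hv).lowerSemicontinuousOn
  ne_bot _ _ := EReal.coe_ne_bot _
  exists_ne_top := hΩne.imp fun _ hx => ⟨hx, EReal.coe_ne_top _⟩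
  test := by
    intro x₀ hx₀ φ hφ hφ0 hφle hφgr
    have hφ0 : v x₀ = φ x₀ := EReal.coe_injective hφ0
    have hφle : ∀ x ∈ Ω, φ x ≤ v x := fun x hx => EReal.coe_le_coe_iff.1 (hφle x hx)
    by_contra hcon
    obtain ⟨c, hc1, hc2⟩ := EReal.lt_iff_exists_real_btwn.1 (not_le.1 hcon)
    have hcf : c < f x₀ (φ x₀) (gradient φ x₀) := EReal.coe_lt_coe_iff.1 hc2
    have hev := eventually_lt_of_limsup_lt hc1
    rw [eventually_nhdsWithin_iff] at hev
    obtain ⟨r₀, hr₀, C, v', hv', hv'v⟩ := hloc x₀ hx₀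
    obtain ⟨R, hR, hRsub⟩ := Metric.nhds_basis_closedBall.mem_iff.1
      (hev.and ((hΩ.eventually_mem hx₀).and (Metric.isOpen_ball.eventually_mem
        (Metric.mem_ball_self hr₀))))
    have hRΩ : Metric.closedBall x₀ R ⊆ Ω := fun x hx => (hRsub hx).2.1
    have hRr : Metric.closedBall x₀ R ⊆ Metric.ball x₀ r₀ := fun x hx => (hRsub hx).2.2
    have hlap : ∀ x ∈ Metric.closedBall x₀ R, x ≠ x₀ → -pLaplacian p φ x ≤ c :=
      fun x hx hxx => (EReal.coe_lt_coe_iff.1 ((hRsub hx).1 hxx)).le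
    obtain ⟨κ, hκ, hκc, hκΩ, hκ1⟩ := exists_smooth_cutoff (isCompact_closedBall x₀ R) hΩ hRΩ
    set φ' : E n → ℝ := fun x => κ x • φ x with hφ'
    have hφ'd : ContDiff ℝ 2 φ' := contDiff_smul_of_tsupport_subset (m := 2) hΩ hκ hκΩ hφ
    have hφ'c : HasCompactSupport φ' := hκc.smul_right
    have hφφ' : ∀ x ∈ Metric.closedBall x₀ R, φ' =ᶠ[𝓝 x] φ := fun x hx => by
      filter_upwards [hκ1 x hx] with y hy
      simp [hφ', hy]
    have hgr : ∀ x ∈ Metric.closedBall x₀ R, gradient φ' x = gradient φ x := fun x hx =>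
      gradient_congr (hφφ' x hx)
    obtain ⟨D, hD⟩ := hφ'd.lipschitzWith_of_hasCompactSupport hφ'c two_ne_zero
    -- The maximum makes φ' ≤ v₁ hold on the whole space, as the comparison requires, while leaving
    -- v unchanged on the closed ball, where φ' = φ ≤ v.
    set v₁ : E n → ℝ := fun x => max (v' x) (φ' x) with hv₁
    have hv₁l : LipschitzWith (max C D) v₁ := hv'.max hD
    have hv₁v : ∀ x ∈ Metric.closedBall x₀ R, v₁ x = v x := fun x hx => by
      simp only [hv₁]
      rw [hv'v (hRr hx), (hφφ' x hx).self_of_nhds, max_eq_left (hφle x (hRΩ hx))]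
    have hx₀R : x₀ ∈ Metric.closedBall x₀ R := Metric.mem_closedBall_self hR.le
    set B := Metric.ball x₀ R with hB
    have hBR : B ⊆ Metric.closedBall x₀ R := Metric.ball_subset_closedBall
    have hBΩ : B ⊆ Ω := hBR.trans hRΩ
    obtain ⟨-, G, hG, -, hfG, hweak⟩ := hu
    have hv₁u : v₁ =ᵐ[volume.restrict B] u := by
      filter_upwards [ae_restrict_of_ae_restrict_of_subset hBΩ hvu,
        ae_restrict_mem Metric.isOpen_ball.measurableSet] with x hx hxB
      rw [hv₁v x (hBR hxB), hx]
    have hGv := hG.ae_eq_gradient Metric.isOpen_ball hBΩ hv₁l hv₁u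
    have hall : ∀ᵐ x, x ∈ B → v₁ x = u x ∧ G x = gradient v₁ x := by
      rw [← ae_restrict_iff' Metric.isOpen_ball.measurableSet]
      exact hv₁u.and hGv
    refine false_of_touching_of_strict hn hp hR
      (hf.mono (Set.prod_mono hRΩ subset_rfl)) hv₁l hφ'd hφ'c (c := c)
      ?_ (fun x => le_max_right _ _) ?_ ?_ ?_ ?_ ?_
    · rw [hv₁v x₀ hx₀R, hφ0, (hφφ' x₀ hx₀R).self_of_nhds]
    · intro x hx hxx
      rw [hgr x hx]
      exact hφgr x (hRΩ hx) hxx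
    · intro x hx hxx
      rw [pLaplacian_congr (ψ := φ)]
      · exact hlap x hx hxx
      · exact (hφφ' x hx).eventuallyEq_nhds.mono fun y hy => gradient_congr hy
    · rwa [hgr x₀ hx₀R, (hφφ' x₀ hx₀R).self_of_nhds]
    · intro K hK hKB
      refine (hfG K hK (hKB.trans hBΩ)).ae_eq ?_
      filter_upwards [ae_restrict_of_ae hall, ae_restrict_mem hK.measurableSet] with x hx hxK
      rw [(hx (hKB hxK)).1, (hx (hKB hxK)).2]
    · intro ψ hψ hψ0
      have hψΩ := hψ.support_subset.trans hBΩ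
      have h1 := hweak ψ ⟨hψ.smooth, hψ.compact, hψΩ⟩ hψ0
      rw [setIntegral_eq_integral_of_forall_compl_eq_zero fun x hx => by
          rw [image_eq_zero_of_notMem_tsupport fun h => hx (hψΩ h), mul_zero],
        setIntegral_eq_integral_of_forall_compl_eq_zero fun x hx => by
          rw [gradient_eq_zero_of_notMem_tsupport fun h => hx (hψΩ h), inner_zero_right]] at h1
      convert! h1 using 1
      · refine integral_congr_ae ?_
        filter_upwards [hall] with x hx
        by_cases hxB : x ∈ B
        · rw [(hx hxB).1, (hx hxB).2, mul_comm]
        · rw [image_eq_zero_of_notMem_tsupport fun h => hxB (hψ.support_subset h), mul_zero,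
            zero_mul]
      · refine integral_congr_ae ?_
        filter_upwards [hall] with x hx
        by_cases hxB : x ∈ B
        · rw [(hx hxB).2]
        · rw [gradient_eq_zero_of_notMem_tsupport fun h => hxB (hψ.support_subset h),
            inner_zero_right, inner_zero_right]

/-- A function in `W^{1,∞}_loc(Ω)` has a locally Lipschitz representative. -/
theorem MemW1Loc.exists_locally_lipschitz {Ω : Set (E n)} (hΩ : IsOpen Ω) {u : E n → ℝ}
    (hu : MemW1Loc ∞ Ω u) :
    ∃ v : E n → ℝ, ContinuousOn v Ω ∧ v =ᵐ[volume.restrict Ω] u ∧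
      ∀ a ∈ Ω, ∃ r > 0, ∃ (C : NNReal) (v' : E n → ℝ), LipschitzWith C v' ∧
        Set.EqOn v' v (Metric.ball a r) := by
  obtain ⟨-, G, hG, hGb⟩ := hu
  have hex : ∀ a : E n, ∃ (r : ℝ) (C : NNReal) (v' : E n → ℝ), a ∈ Ω →
      0 < r ∧ Metric.ball a r ⊆ Ω ∧ LipschitzWith C v' ∧
        v' =ᵐ[volume.restrict (Metric.ball a r)] u := by
    intro a
    by_cases ha : a ∈ Ω
    · obtain ⟨s, hs, hsΩ⟩ := Metric.nhds_basis_closedBall.mem_iff.1 (hΩ.mem_nhds ha)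
      have hs2 : Metric.closedBall a (2 * (s / 2)) ⊆ Ω := by rwa [mul_div_cancel₀ _ two_ne_zero]
      obtain ⟨C, v', h1, h2⟩ := exists_lipschitzWith_ae_eq hG hGb (half_pos hs) hs2
      refine ⟨s / 2, C, v', fun _ => ⟨half_pos hs, ?_, h1, h2⟩⟩
      exact (Metric.ball_subset_closedBall.trans
        (Metric.closedBall_subset_closedBall (by linarith))).trans hs2
    · exact ⟨0, 0, 0, fun h => absurd h ha⟩
  -- The local representatives are glued along the diagonal x ↦ V x x. Two of them agree on the
  -- overlap of their balls, being continuous and almost everywhere equal on an open set.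
  choose r C V hV using hex
  have hglue : ∀ a ∈ Ω, Set.EqOn (V a) (fun x => V x x) (Metric.ball a (r a)) := by
    intro a ha x hx
    have hxΩ := (hV a ha).2.1 hx
    have hO : IsOpen (Metric.ball a (r a) ∩ Metric.ball x (r x)) :=
      Metric.isOpen_ball.inter Metric.isOpen_ball
    have h1 : V a =ᵐ[volume.restrict (Metric.ball a (r a) ∩ Metric.ball x (r x))] V x := by
      filter_upwards [ae_restrict_of_ae_restrict_of_subset Set.inter_subset_left (hV a ha).2.2.2,
        ae_restrict_of_ae_restrict_of_subset Set.inter_subset_right (hV x hxΩ).2.2.2]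
        with y h1 h2 using h1.trans h2.symm
    exact Measure.eqOn_open_of_ae_eq h1 hO (hV a ha).2.2.1.continuous.continuousOn
      (hV x hxΩ).2.2.1.continuous.continuousOn ⟨hx, Metric.mem_ball_self (hV x hxΩ).1⟩
  refine ⟨fun x => V x x, fun a ha => ?_, ?_, fun a ha =>
    ⟨r a, (hV a ha).1, C a, V a, (hV a ha).2.2.1, hglue a ha⟩⟩
  · refine ContinuousAt.continuousWithinAt
      ((hV a ha).2.2.1.continuous.continuousAt.congr ?_)
    filter_upwards [Metric.ball_mem_nhds a (hV a ha).1] with x hx using hglue a ha hx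
  -- A countable subcover keeps the union of the exceptional null sets null.
  · obtain ⟨t, htΩ, htc, hcov⟩ := TopologicalSpace.countable_cover_nhdsWithin (s := Ω)
      (f := fun a => Metric.ball a (r a)) fun a ha =>
        mem_nhdsWithin_of_mem_nhds (Metric.ball_mem_nhds a (hV a ha).1)
    refine ae_restrict_of_ae_restrict_of_subset hcov ?_
    rw [ae_restrict_biUnion_iff _ htc]
    intro a hat
    have ha := htΩ hat
    filter_upwards [(hV a ha).2.2.2, ae_restrict_mem Metric.isOpen_ball.measurableSet]
      with x hx hxb
    rw [← hx]
    exact (hglue a ha hxb).symm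

theorem exists_lipschitzWith_eqOn_ball_of_contDiffOn {Ω : Set (E n)} (hΩ : IsOpen Ω)
    {u : E n → ℝ} (hu : ContDiffOn ℝ 1 u Ω) {a : E n} (ha : a ∈ Ω) :
    ∃ r > 0, ∃ (C : NNReal) (v' : E n → ℝ), LipschitzWith C v' ∧
      Set.EqOn v' u (Metric.ball a r) := by
  obtain ⟨C, t, ht, hC⟩ := (hu.contDiffAt (hΩ.mem_nhds ha)).exists_lipschitzOnWith
  obtain ⟨r, hr, hrt⟩ := Metric.mem_nhds_iff.1 ht
  obtain ⟨v', hv', hv'u⟩ := (hC.mono hrt).extend_real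
  exact ⟨r, hr, C, v', hv', hv'u.symm⟩

end PLap

end

/-! ### The three cases. -/

theorem theorem1p2 {n : ℕ} (hn : 1 ≤ n) (Ω : Set (PLap.E n)) (hΩ : IsOpen Ω)
    (hΩb : Bornology.IsBounded Ω) (hΩne : Ω.Nonempty)
    (f : PLap.E n → ℝ → PLap.E n → ℝ)
    (hf : ContinuousOn (fun z : PLap.E n × ℝ × PLap.E n => f z.1 z.2.1 z.2.2)
      (Ω ×ˢ Set.univ))
    (hmono : ∀ x ∈ Ω, ∀ η : PLap.E n, Antitone (fun s : ℝ => f x s η))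
    (hlip : ∀ x ∈ Ω, ∀ s : ℝ, LocallyLipschitz (fun η : PLap.E n => f x s η)) :
    -- (i)
    (∀ (p : ℝ) (u : PLap.E n → ℝ), 1 < p → p ≤ 2 →
      PLap.MemW1Loc ∞ Ω u → PLap.IsWeakSupersolution Ω p f u →
      ∃ v : PLap.E n → ℝ, ContinuousOn v Ω ∧ v =ᵐ[volume.restrict Ω] u ∧
        PLap.IsViscositySupersolution Ω p f (fun x => (v x : EReal))) ∧
    -- (ii)
    (∀ (p : ℝ) (u : PLap.E n → ℝ), 2 < p → (∀ x ∈ Ω, ∀ s : ℝ, f x s 0 = 0) →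
      ContDiffOn ℝ 1 u Ω → PLap.IsWeakSupersolution Ω p f u →
      PLap.IsViscositySupersolution Ω p f (fun x => (u x : EReal))) ∧
    -- (iii)
    (∀ (p : ℝ) (u : PLap.E n → ℝ) (G : PLap.E n → PLap.E n), 2 < p →
      PLap.MemW1Loc ∞ Ω u → PLap.IsWeakSupersolution Ω p f u →
      PLap.HasWeakGradient Ω u G → (∀ᵐ x ∂(volume.restrict Ω), G x ≠ 0) →
      ∃ v : PLap.E n → ℝ, ContinuousOn v Ω ∧ v =ᵐ[volume.restrict Ω] u ∧
        PLap.IsViscositySupersolution Ω p f (fun x => (v x : EReal))) := by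
  have hcore : ∀ (p : ℝ) (u : PLap.E n → ℝ), 1 < p → PLap.MemW1Loc ∞ Ω u →
      PLap.IsWeakSupersolution Ω p f u →
      ∃ v : PLap.E n → ℝ, ContinuousOn v Ω ∧ v =ᵐ[volume.restrict Ω] u ∧
        PLap.IsViscositySupersolution Ω p f (fun x => (v x : EReal)) := by
    intro p u hp hu hw
    obtain ⟨v, hv, hvu, hloc⟩ := hu.exists_locally_lipschitz hΩ
    exact ⟨v, hv, hvu, hw.isViscositySupersolution hn hΩ hΩne hf hp hv hvu hloc⟩
  refine ⟨fun p u hp _ hu hw => hcore p u hp hu hw, fun p u hp _ hu hw => ?_,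
    fun p u _ hp hu hw _ _ => hcore p u (by linarith) hu hw⟩
  -- Here u is C¹ and serves as its own representative.
  exact hw.isViscositySupersolution hn hΩ hΩne hf (by linarith) hu.continuousOn
    (EventuallyEq.refl _ _) fun a ha => PLap.exists_lipschitzWith_eqOn_ball_of_contDiffOn hΩ hu ha
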